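/- **Setting.** Fix $\mu_0>0$, let $S^1=\mathbb R/\tfrac{2\pi}{\mu_0}\mathbb Z$, and give $S^1\times\mathbb R^3$ (coordinates $(t,\vec x)$) the flat metric and the orientation $dt\wedge dx^1\wedge dx^2\wedge dx^3$. Let $S^2_\infty$ be the boundary sphere of the radial compactification of $\mathbb R^3$ to a closed ball, let $W_\infty=S^2_\infty\times\mathbb C^2=L_+\oplus L_-$ (the two coordinate line bundles), and let $\Phi_\infty=\mathrm{diag}(\imath\mu_0/4,-\imath\mu_0/4)$. *Calorons.* A framed connection is a pair $(A,f)$ of a smooth $SU(2)$ connection $d+A$ on the trivial rank 2 bundle over $S^1\times\mathbb R^3$ and a smooth framing $f:S^1\times S^2_\infty\to SU(2)$. Two pairs are equivalent, $[A,f]=[A',f']$, if there is a smooth $g:S^1\times\mathbb R^3\to SU(2)$ with $A'=gAg^{-1}-dg\,g^{-1}$ that tends, uniformly as $|\vec x|\to\infty$, to $f'^{-1}f$ on $S^1\times S^2_\infty$. Let $k\ge1$. A $(k,k)$-caloron with equal monopole masses $\nu_1=\nu_2=\mu_0/2$ is a class $[A,f]$ with a representative such that: the curvature satisfies $\star F=-F$;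 the action $-\int\mathrm{tr}(F\wedge\star F)$ is finite; $A$ extends smoothly to $S^1\times S^2_\infty$, where its restriction satisfies $fAf^{-1}-df\,f^{-1}=\Phi_\infty\,dt$; and the charge is $\frac1{8\pi^2}\int\mathrm{tr}(F\wedge F)=k$. The set of all such classes is $\mathcal C_k$. *Symmetries.* Let $J=\begin{pmatrix}0&1\\-1&0\end{pmatrix}$, which exchanges $L_+$ and $L_-$ and satisfies $J(-\Phi_\infty)J^{-1}=\Phi_\infty$. The following bijections act on classes of framed connections. - *Euclidean symmetries.* An isometry $E(t,\vec x)=(\pm t+s,R\vec x)$ with $R\in O(3)$ that preserves the orientation acts by pull-back, $[A,f]\mapsto[E^*A,E^*f]$, and by $[A,f]\mapsto[E^*A,J\,E^*f]$ if it reverses $t$. - *Phases.* For $\omega\in\mathbb R$, $P(\omega)[A,f]=[A,\mathrm{diag}(e^{\imath\omega},e^{-\imath\omega})f]$. - *The rotation map.* With the anti-periodic large gauge transformation $c(t)=\mathrm{diag}(e^{\imath\mu_0t/2},e^{-\imath\mu_0t/2})$, i.e. $e^{\pm\imath\mu_0t/2}$ on $L_\pm$, one sets $\rho[A,f]=[\,cAc^{-1}-dc\,c^{-1},\;J\,c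 f c^{-1}]$. Let $\mathcal S$ be the group generated by all of these. For a subgroup $H\subset\mathcal S$, a $(k,k)$-caloron is *$H$-symmetric* if it is fixed by every element of $H$, and $\mathcal C_k(H)$ denotes the set of $H$-symmetric $(k,k)$-calorons in $\mathcal C_k$. **Proposition.** Let $k\ge 1$ and let $H\subset\mathcal S$ be a subgroup with $P(\omega)\rho\in H$ for some $\omega\in\mathbb R$. Then $\mathcal C_k(H)=\emptyset$. -/

import Mathlib

open Filter Topology MeasureTheory
open scoped ContDiff

noncomputable section

namespace Caloron

/-! ### Space-time, `SU(2)` and `su(2)` -/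

/-- Complex `2 × 2` matrices, as a normed real algebra with the conjugate transpose as `star`.
(A type synonym of `Matrix (Fin 2) (Fin 2) ℂ`, because matrices carry no default norm in Mathlib.
The norm is only used for the calculus of matrix valued functions.) -/
def Mat : Type := Matrix (Fin 2) (Fin 2) ℂ

open scoped Matrix.Norms.Operator in
instance : NormedRing Mat := inferInstanceAs (NormedRing (Matrix (Fin 2) (Fin 2) ℂ))

open scoped Matrix.Norms.Operator in
instance : NormedAlgebra ℝ Mat :=
  inferInstanceAs (NormedAlgebra ℝ (Matrix (Fin 2) (Fin 2) ℂ))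

instance : StarRing Mat := inferInstanceAs (StarRing (Matrix (Fin 2) (Fin 2) ℂ))

instance : StarModule ℝ Mat := inferInstanceAs (StarModule ℝ (Matrix (Fin 2) (Fin 2) ℂ))

instance : ContinuousStar Mat :=
  ⟨(continuous_id.matrix_conjTranspose : Continuous fun X : Matrix (Fin 2) (Fin 2) ℂ => X.conjTranspose)⟩

/-- The trace. -/
def Mat.trace (X : Mat) : ℂ := Matrix.trace (X : Matrix (Fin 2) (Fin 2) ℂ)

/-- The determinant. -/
def Mat.det (X : Mat) : ℂ := Matrix.det (X : Matrix (Fin 2) (Fin 2) ℂ)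

/-- The matrix with the given entries. -/
def Mat.of (X : Matrix (Fin 2) (Fin 2) ℂ) : Mat := X

/-- Euclidean three-space. -/
abbrev Space : Type := EuclideanSpace ℝ (Fin 3)

/-- The universal cover `ℝ × ℝ³` of `S¹ × ℝ³`, with coordinates `(t, x)`. Objects on `S¹ × ℝ³` are
objects on the cover that are periodic in `t`. -/
abbrev Spacetime : Type := ℝ × Space

/-- The group `SU(2)`, as a set of matrices; the inverse of `g` is `star g`. -/
def SU2 : Submonoid Mat := Matrix.specialUnitaryGroup (Fin 2) ℂ

/-- The Lie algebra `su(2)`: trace-free skew-hermitian matrices. -/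
def IsSu2 (X : Mat) : Prop := star X = -X ∧ X.trace = 0

/-- The circumference `2π/μ₀` of the circle. -/
def period (μ₀ : ℝ) : ℝ := 2 * Real.pi / μ₀

/-- Spatial infinity `r → ∞`, uniformly in `t` and in the direction. -/
def spatialInfinity : Filter Spacetime := comap (fun p : Spacetime => ‖p.2‖) atTop

/-- The standard coordinate vector fields `∂₀ = ∂/∂t, ∂₁, ∂₂, ∂₃`. -/
def basisVec : Fin 4 → Spacetime :=
  Fin.cons ((1 : ℝ), (0 : Space)) fun i : Fin 3 => ((0 : ℝ), EuclideanSpace.single i (1 : ℝ))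

/-! ### Framed connections -/

/-- An `SU(2)` connection `d + A` on the trivial rank two bundle `V` over `S¹ × ℝ³`, together with
a framing `f : V|_∞ → p_∞^* W_∞` over `S¹ × S²_∞`, where `W_∞ = S²_∞ × ℂ²`.
A smooth map on `S¹ × S²` is encoded by its radial extension to `x ≠ 0`. -/
@[ext]
structure FramedConnection (μ₀ : ℝ) where
  /-- the connection one-form -/
  conn : Spacetime → Spacetime →L[ℝ] Mat
  /-- the framing, radially extended -/
  frame : Spacetime → Mat
  conn_smooth : ContDiff ℝ ∞ conn
  conn_su2 : ∀ p v, IsSu2 (conn p v)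
  conn_periodic : ∀ t x, conn (t + period μ₀, x) = conn (t, x)
  frame_smooth : ContDiffOn ℝ ∞ frame {p | p.2 ≠ 0}
  frame_SU2 : ∀ p, frame p ∈ SU2
  frame_periodic : ∀ t x, frame (t + period μ₀, x) = frame (t, x)
  frame_radial : ∀ t x, ∀ s : ℝ, 0 < s → frame (t, s • x) = frame (t, x)

/-- The gauge transformation `g` takes the connection `A` to `B = g A g⁻¹ - dg g⁻¹`. -/
def GaugeTakes (g : Spacetime → Mat) (A B : Spacetime → Spacetime →L[ℝ] Mat) : Prop :=
  ∀ p v, B p v = g p * A p v * star (g p) - fderiv ℝ g p v * star (g p)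

/-- Isomorphism of framed connections: a (periodic) gauge transformation `g` that intertwines the
connections, and which is the identity at `r = ∞` when it is read in the framings. If the two
framings agree, this is equivalence under a framed gauge transformation. -/
def GaugeEquiv {μ₀ : ℝ} (a b : FramedConnection μ₀) : Prop :=
  ∃ g : Spacetime → Mat, ContDiff ℝ ∞ g ∧ (∀ p, g p ∈ SU2) ∧
    (∀ t x, g (t + period μ₀, x) = g (t, x)) ∧ GaugeTakes g a.conn b.conn ∧
    Tendsto (fun p => b.frame p * g p * star (a.frame p)) spatialInfinity (𝓝 1)

lemma star_mul_of_SU2 {g : Mat} (h : g ∈ SU2) : star g * g = 1 :=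
  (Matrix.mem_specialUnitaryGroup_iff.1 h).1.1

lemma mul_star_of_SU2 {g : Mat} (h : g ∈ SU2) : g * star g = 1 :=
  (Matrix.mem_specialUnitaryGroup_iff.1 h).1.2

lemma star_mem_SU2 {g : Mat} (h : g ∈ SU2) : star g ∈ SU2 :=
  (star (⟨g, h⟩ : Matrix.specialUnitaryGroup (Fin 2) ℂ)).2

lemma gaugeTakes_iff {g : Spacetime → Mat} (hg : ∀ p, g p ∈ SU2)
    {A B : Spacetime → Spacetime →L[ℝ] Mat} :
    GaugeTakes g A B ↔ ∀ p v, fderiv ℝ g p v = g p * A p v - B p v * g p := by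
  refine forall₂_congr fun p v => ?_
  have h1 := star_mul_of_SU2 (hg p)
  have h2 := mul_star_of_SU2 (hg p)
  constructor
  · intro h
    rw [h, sub_mul, mul_assoc, mul_assoc _ (star (g p)), h1]
    simp
  · intro h
    rw [h, sub_mul, mul_assoc (B p v), h2]
    simp

lemma contDiff_star {g : Spacetime → Mat} (hg : ContDiff ℝ ∞ g) :
    ContDiff ℝ ∞ fun p => star (g p) :=
  (starL' ℝ : Mat ≃L[ℝ] Mat).contDiff.comp hg

lemma fderiv_star_mat {g : Spacetime → Mat} (hg : ContDiff ℝ ∞ g) (p v : Spacetime) :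
    fderiv ℝ (fun p => star (g p)) p v = star (fderiv ℝ g p v) := by
  have h := ((hg.differentiable (by simp)) p).hasFDerivAt.star
  rw [h.fderiv]
  simp

lemma fderiv_mul_mat {g h : Spacetime → Mat} (hg : ContDiff ℝ ∞ g) (hh : ContDiff ℝ ∞ h)
    (p v : Spacetime) :
    fderiv ℝ (fun p => g p * h p) p v = g p * fderiv ℝ h p v + fderiv ℝ g p v * h p := by
  have h' := ((hg.differentiable (by simp)) p).hasFDerivAt.mul'
    ((hh.differentiable (by simp)) p).hasFDerivAt
  have : fderiv ℝ (fun p => g p * h p) p = _ := h'.fderiv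
  rw [this]
  simp

lemma GaugeEquiv.refl {μ₀ : ℝ} (a : FramedConnection μ₀) : GaugeEquiv a a := by
  refine ⟨fun _ => 1, contDiff_const, fun _ => one_mem _, fun _ _ => rfl, ?_, ?_⟩
  · intro p v; simp
  · simp only [mul_one, mul_star_of_SU2 (a.frame_SU2 _)]
    exact tendsto_const_nhds

lemma GaugeEquiv.symm {μ₀ : ℝ} {a b : FramedConnection μ₀} (h : GaugeEquiv a b) :
    GaugeEquiv b a := by
  obtain ⟨g, hs, hU, hp, hA, hl⟩ := h
  refine ⟨fun p => star (g p), contDiff_star hs, fun p => star_mem_SU2 (hU p),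
    fun t x => by simp only [hp], ?_, ?_⟩
  · rw [gaugeTakes_iff hU] at hA
    rw [gaugeTakes_iff fun p => star_mem_SU2 (hU p)]
    intro p v
    rw [fderiv_star_mat hs, hA]
    simp only [star_sub, star_mul, (a.conn_su2 p v).1, (b.conn_su2 p v).1]
    noncomm_ring
  · have := hl.star
    simpa [star_mul, mul_assoc] using this

lemma GaugeEquiv.trans {μ₀ : ℝ} {a b c : FramedConnection μ₀} (h : GaugeEquiv a b)
    (h' : GaugeEquiv b c) : GaugeEquiv a c := by
  obtain ⟨g, hs, hU, hp, hA, hl⟩ := h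
  obtain ⟨k, ks, kU, kp, kA, kl⟩ := h'
  refine ⟨fun p => k p * g p, ks.mul hs, fun p => mul_mem (kU p) (hU p),
    fun t x => by simp only [hp, kp], ?_, ?_⟩
  · rw [gaugeTakes_iff hU] at hA
    rw [gaugeTakes_iff kU] at kA
    rw [gaugeTakes_iff fun p => mul_mem (kU p) (hU p)]
    intro p v
    rw [fderiv_mul_mat ks hs, hA, kA]
    noncomm_ring
  · have := kl.mul hl
    rw [one_mul] at this
    refine this.congr fun p => ?_
    rw [show c.frame p * k p * star (b.frame p) * (b.frame p * g p * star (a.frame p))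
      = c.frame p * k p * (star (b.frame p) * b.frame p) * g p * star (a.frame p) by noncomm_ring,
      star_mul_of_SU2 (b.frame_SU2 p)]
    noncomm_ring

instance framedSetoid (μ₀ : ℝ) : Setoid (FramedConnection μ₀) :=
  ⟨GaugeEquiv, GaugeEquiv.refl, GaugeEquiv.symm, GaugeEquiv.trans⟩

/-- Isomorphism classes of framed connections. -/
abbrev ModuliSpace (μ₀ : ℝ) : Type := Quotient (framedSetoid μ₀)

/-! ### Calorons -/

/-- The curvature `F = dA + A ∧ A`, evaluated on two vectors. -/
def curvature (A : Spacetime → Spacetime →L[ℝ] Mat) (p v w : Spacetime) : Mat :=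
  fderiv ℝ A p v w - fderiv ℝ A p w v + (A p v * A p w - A p w * A p v)

/-- The components `F_{ij} = F(∂_i, ∂_j)`. -/
def curvComp (A : Spacetime → Spacetime →L[ℝ] Mat) (i j : Fin 4) (p : Spacetime) : Mat :=
  curvature A p (basisVec i) (basisVec j)

/-- `⋆F = -F` for the flat metric and the orientation `dt ∧ dx¹ ∧ dx² ∧ dx³`. -/
def AntiSelfDual (A : Spacetime → Spacetime →L[ℝ] Mat) : Prop :=
  ∀ p, curvComp A 2 3 p = -curvComp A 0 1 p ∧ curvComp A 3 1 p = -curvComp A 0 2 p ∧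
    curvComp A 1 2 p = -curvComp A 0 3 p

/-- One period `[0, 2π/μ₀) × ℝ³`, a fundamental domain of `S¹ × ℝ³`. -/
def fundamentalDomain (μ₀ : ℝ) : Set Spacetime := {p | 0 ≤ p.1 ∧ p.1 < period μ₀}

/-- The Yang–Mills density `-tr (F ∧ ⋆F) = -∑_{i<j} tr (F_{ij}²)`. -/
def actionDensity (A : Spacetime → Spacetime →L[ℝ] Mat) (p : Spacetime) : ℝ :=
  -∑ i : Fin 4, ∑ j ∈ Finset.Ioi i, (curvComp A i j p * curvComp A i j p).trace.re

/-- The density `tr (F ∧ F)`. -/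
def chernDensity (A : Spacetime → Spacetime →L[ℝ] Mat) (p : Spacetime) : ℝ :=
  2 * (curvComp A 0 1 p * curvComp A 2 3 p + curvComp A 0 2 p * curvComp A 3 1 p
    + curvComp A 0 3 p * curvComp A 1 2 p).trace.re

/-- The caloron charge `Q = (1/8π²) ∫_{S¹ × ℝ³} tr (F ∧ F)`. -/
def charge (μ₀ : ℝ) (A : Spacetime → Spacetime →L[ℝ] Mat) : ℝ :=
  1 / (8 * Real.pi ^ 2) * ∫ p in fundamentalDomain μ₀, chernDensity A p

/-- The radial compactification: `(t, y) ↦ (t, y / (1 - |y|²))` is a diffeomorphism from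
`ℝ × (open unit ball)` onto `ℝ × ℝ³`, and near the unit sphere, which is `S²_∞`, the function
`1/r = (1 - |y|²)/|y|` is a smooth boundary defining function. -/
def ballChart (q : Spacetime) : Spacetime := (q.1, (1 - ‖q.2‖ ^ 2)⁻¹ • q.2)

/-- The Higgs field at infinity for equal monopole masses, `Φ_∞ = diag(iμ, -iμ)` with `μ = μ₀/4`
(so that `ν₁ = 2μ` and `ν₂ = μ₀ - 2μ` are both `μ₀/2`). The eigenbundles `L_+`, `L_-` are the two
coordinate line bundles of `W_∞ = S²_∞ × ℂ²`. -/
def higgsInfinity (μ₀ : ℝ) : Mat :=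
  Mat.of <| Matrix.diagonal ![Complex.I * (μ₀ / 4), -(Complex.I * (μ₀ / 4))]

/-- The boundary condition `A|_{S¹ × S²_∞} = Φ_∞ dt + a_∞`, read in the framing, for magnetic charge
zero, where `L_±` are trivial and `a_∞ = 0`: the connection extends smoothly to the
compactification `S¹ × (closed ball)`, and its pull-back to the boundary is the gauge transform by
`f⁻¹` of `Φ_∞ dt`, that is `f A f⁻¹ - df f⁻¹ = Φ_∞ dt` on all vectors tangent to the boundary. -/
def BoundaryCondition {μ₀ : ℝ} (a : FramedConnection μ₀) : Prop :=
  ∃ Abar : Spacetime → Spacetime →L[ℝ] Mat, ContDiff ℝ ∞ Abar ∧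
    (∀ q : Spacetime, ‖q.2‖ < 1 →
      Abar q = (a.conn (ballChart q)).comp (fderiv ℝ ballChart q)) ∧
    ∀ q v : Spacetime, ‖q.2‖ = 1 → inner ℝ q.2 v.2 = 0 →
      a.frame q * Abar q v * star (a.frame q) - fderiv ℝ a.frame q v * star (a.frame q)
        = v.1 • higgsInfinity μ₀

/-- Framed `(k,k)`-caloron configurations with equal masses: finite action anti-self-dual framed
connections satisfying the boundary condition, whose charge
`Q = (m₁ ν₁ + m₂ ν₂)/μ₀` is `k`. -/
structure IsCaloron {μ₀ : ℝ} (k : ℕ) (a : FramedConnection μ₀) : Prop where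
  asd : AntiSelfDual a.conn
  finite_action : IntegrableOn (actionDensity a.conn) (fundamentalDomain μ₀)
  boundary : BoundaryCondition a
  charge_eq : charge μ₀ a.conn = k

/-- The moduli space `𝒞_k` of framed `(k,k)`-calorons with equal masses. -/
def calorons (μ₀ : ℝ) (k : ℕ) : Set (ModuliSpace μ₀) :=
  {x | ∃ a : FramedConnection μ₀, IsCaloron k a ∧ (⟦a⟧ : ModuliSpace μ₀) = x}

/-! ### The symmetries -/

/-- `diag(e^{iθ}, e^{-iθ})`, i.e. multiplication by `e^{±iθ}` on `L_±`. -/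
def diagPhase (θ : ℝ) : Mat :=
  Mat.of <| Matrix.diagonal ![Complex.exp (Complex.I * θ), Complex.exp (-(Complex.I * θ))]

/-- The automorphism of `W_∞` which exchanges `L_+` and `L_-`. It is parallel for `a_∞` and takes
`-Φ_∞` to `Φ_∞`; these properties determine it up to a phase `diagPhase θ`. -/
def swap : Mat := Mat.of !![0, 1; -1, 0]

lemma diagPhase_mem (θ : ℝ) : diagPhase θ ∈ SU2 := by
  have h : (starRingEnd ℂ) (Complex.exp (Complex.I * θ)) = Complex.exp (-(Complex.I * θ)) := by
    rw [← Complex.exp_conj]; simp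
  have h' : (starRingEnd ℂ) (Complex.exp (-(Complex.I * θ))) = Complex.exp (Complex.I * θ) := by
    rw [← Complex.exp_conj]; simp
  refine Matrix.mem_specialUnitaryGroup_iff.2 ⟨Matrix.mem_unitaryGroup_iff.2 ?_, ?_⟩
  · ext i j
    fin_cases i <;> fin_cases j <;>
      simp [diagPhase, Mat.of, Matrix.star_eq_conjTranspose, Matrix.mul_apply, h, h',
        ← Complex.exp_add]
  · simp [diagPhase, Mat.of, Matrix.det_diagonal, ← Complex.exp_add]

lemma swap_mem : swap ∈ SU2 := by
  refine Matrix.mem_specialUnitaryGroup_iff.2 ⟨Matrix.mem_unitaryGroup_iff.2 ?_, ?_⟩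
  · ext i j
    fin_cases i <;> fin_cases j <;>
      simp [swap, Mat.of, Matrix.star_eq_conjTranspose, Matrix.mul_apply]
  · simp [swap, Mat.of, Matrix.det_fin_two]

lemma Mat.trace_mul_comm (X Y : Mat) : (X * Y).trace = (Y * X).trace :=
  Matrix.trace_mul_comm (X : Matrix (Fin 2) (Fin 2) ℂ) Y

lemma Mat.trace_sub (X Y : Mat) : (X - Y).trace = X.trace - Y.trace :=
  Matrix.trace_sub (X : Matrix (Fin 2) (Fin 2) ℂ) Y

lemma Mat.trace_smul (r : ℝ) (X : Mat) : (r • X).trace = r • X.trace :=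
  Matrix.trace_smul r (X : Matrix (Fin 2) (Fin 2) ℂ)

lemma IsSu2.conj {X g : Mat} (hX : IsSu2 X) (hg : g ∈ SU2) : IsSu2 (g * X * star g) := by
  refine ⟨?_, ?_⟩
  · simp [star_mul, hX.1, mul_assoc]
  · rw [Mat.trace_mul_comm, ← mul_assoc, star_mul_of_SU2 hg, one_mul, hX.2]

lemma IsSu2.sub {X Y : Mat} (hX : IsSu2 X) (hY : IsSu2 Y) : IsSu2 (X - Y) := by
  refine ⟨?_, ?_⟩
  · rw [star_sub, hX.1, hY.1]; abel
  · rw [Mat.trace_sub, hX.2, hY.2, sub_zero]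

lemma IsSu2.smul {X : Mat} (r : ℝ) (hX : IsSu2 X) : IsSu2 (r • X) := by
  refine ⟨?_, ?_⟩
  · rw [star_smul, hX.1]; simp
  · rw [Mat.trace_smul, hX.2, smul_zero]

/-- An isometry `(t, x) ↦ (± t + s, R x)` of `S¹ × ℝ³` with `R ∈ O(3)`, preserving the orientation:
an element of `(O(2) × O(3))₊`. -/
structure EuclideanIsometry where
  /-- the sign of the action on the circle -/
  sign : ℤˣ
  /-- the translation along the circle -/
  shift : ℝ
  /-- the action on `ℝ³` -/
  rot : Space ≃ₗᵢ[ℝ] Space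
  orientation : ((sign : ℤ) : ℝ) * LinearMap.det (rot.toLinearEquiv : Space →ₗ[ℝ] Space) = 1

namespace EuclideanIsometry

/-- The sign as a real number. -/
def sgn (E : EuclideanIsometry) : ℝ := ((E.sign : ℤ) : ℝ)

lemma sgn_eq (E : EuclideanIsometry) : E.sgn = 1 ∨ E.sgn = -1 := by
  rcases Int.units_eq_one_or E.sign with h | h <;> simp [sgn, h]

lemma sgn_mul_self (E : EuclideanIsometry) : E.sgn * E.sgn = 1 := by
  rcases E.sgn_eq with h | h <;> simp [h]

/-- The isometry as a map. -/
def toFun (E : EuclideanIsometry) (p : Spacetime) : Spacetime := (E.sgn * p.1 + E.shift, E.rot p.2)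

/-- The (constant) differential of the isometry. -/
def lin (E : EuclideanIsometry) : Spacetime →L[ℝ] Spacetime :=
  (E.sgn • ContinuousLinearMap.id ℝ ℝ).prodMap
    (E.rot.toContinuousLinearEquiv : Space →L[ℝ] Space)

/-- The inverse isometry. -/
def inv (E : EuclideanIsometry) : EuclideanIsometry where
  sign := E.sign
  shift := -(E.sgn * E.shift)
  rot := E.rot.symm
  orientation := by
    have h := E.orientation
    have hs : ((E.sign : ℤ) : ℝ) * ((E.sign : ℤ) : ℝ) = 1 := E.sgn_mul_self
    have h2 : LinearMap.det (E.rot.symm.toLinearEquiv : Space →ₗ[ℝ] Space)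
        * LinearMap.det (E.rot.toLinearEquiv : Space →ₗ[ℝ] Space) = 1 := by
      rw [← LinearMap.det_comp]
      have : (E.rot.symm.toLinearEquiv : Space →ₗ[ℝ] Space) ∘ₗ
          (E.rot.toLinearEquiv : Space →ₗ[ℝ] Space) = LinearMap.id := by
        ext1 x; simp
      rw [this, LinearMap.det_id]
    linear_combination h2 - LinearMap.det (E.rot.symm.toLinearEquiv : Space →ₗ[ℝ] Space) *
      (((E.sign : ℤ) : ℝ) * h - LinearMap.det (E.rot.toLinearEquiv : Space →ₗ[ℝ] Space) * hs)

lemma toFun_inv (E : EuclideanIsometry) (p : Spacetime) : E.toFun (E.inv.toFun p) = p := by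
  have h := E.sgn_mul_self
  ext1
  · change E.sgn * (E.sgn * p.1 + -(E.sgn * E.shift)) + E.shift = p.1
    linear_combination (p.1 - E.shift) * h
  · exact E.rot.apply_symm_apply p.2

lemma inv_toFun (E : EuclideanIsometry) (p : Spacetime) : E.inv.toFun (E.toFun p) = p := by
  have h := E.sgn_mul_self
  ext1
  · change E.sgn * (E.sgn * p.1 + E.shift) + -(E.sgn * E.shift) = p.1
    linear_combination p.1 * h
  · exact E.rot.symm_apply_apply p.2

lemma lin_inv (E : EuclideanIsometry) (v : Spacetime) : E.lin (E.inv.lin v) = v := by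
  have h := E.sgn_mul_self
  ext1
  · change E.sgn * (E.sgn * v.1) = v.1
    linear_combination v.1 * h
  · exact E.rot.apply_symm_apply v.2

lemma inv_lin (E : EuclideanIsometry) (v : Spacetime) : E.inv.lin (E.lin v) = v := by
  have h := E.sgn_mul_self
  ext1
  · change E.sgn * (E.sgn * v.1) = v.1
    linear_combination v.1 * h
  · exact E.rot.symm_apply_apply v.2

lemma toFun_eq (E : EuclideanIsometry) : E.toFun = fun p => E.lin p + (E.shift, 0) := by
  funext p
  ext1
  · rfl
  · exact (add_zero (E.rot p.2)).symm

lemma hasFDerivAt (E : EuclideanIsometry) (p : Spacetime) : HasFDerivAt E.toFun E.lin p := by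
  rw [toFun_eq]
  exact E.lin.hasFDerivAt.add_const _

lemma contDiff (E : EuclideanIsometry) : ContDiff ℝ ∞ E.toFun := by
  rw [toFun_eq]
  exact E.lin.contDiff.add contDiff_const

lemma periodic {α : Type*} {φ : Spacetime → α} {T : ℝ} (hφ : ∀ t x, φ (t + T, x) = φ (t, x))
    (E : EuclideanIsometry) (t : ℝ) (x : Space) : φ (E.toFun (t + T, x)) = φ (E.toFun (t, x)) := by
  simp only [toFun]
  rcases E.sgn_eq with h | h
  · rw [h, ← hφ (1 * t + E.shift)]
    congr 2; ring
  · rw [h, ← hφ (-1 * (t + T) + E.shift)]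
    congr 2; ring

lemma tendsto_spatialInfinity (E : EuclideanIsometry) :
    Tendsto E.toFun spatialInfinity spatialInfinity := by
  refine tendsto_comap_iff.2 ?_
  have : (fun p : Spacetime => ‖p.2‖) ∘ E.toFun = fun p => ‖p.2‖ := by
    funext p; exact E.rot.norm_map p.2
  rw [this]
  exact tendsto_comap

end EuclideanIsometry

/-- The identity isometry. -/
def EuclideanIsometry.id : EuclideanIsometry :=
  ⟨1, 0, LinearIsometryEquiv.refl ℝ Space, by
    have : ((LinearIsometryEquiv.refl ℝ Space).toLinearEquiv : Space →ₗ[ℝ] Space)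
      = LinearMap.id := rfl
    rw [this]; simp⟩

namespace FramedConnection

variable {μ₀ : ℝ}

/-- Pull-back of the connection and of the framing by a euclidean isometry, followed by the constant
automorphism `K` of `W_∞`: `(A, f) ↦ (E^* A, K ∘ E^* f)`. -/
def pullback (E : EuclideanIsometry) (K : Mat) (hK : K ∈ SU2) (a : FramedConnection μ₀) :
    FramedConnection μ₀ where
  conn p := (a.conn (E.toFun p)).comp E.lin
  frame p := K * a.frame (E.toFun p)
  conn_smooth := (a.conn_smooth.comp E.contDiff).clm_comp contDiff_const
  conn_su2 p v := a.conn_su2 _ _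
  conn_periodic t x := by rw [EuclideanIsometry.periodic a.conn_periodic]
  frame_smooth := by
    refine contDiffOn_const.mul (a.frame_smooth.comp E.contDiff.contDiffOn ?_)
    intro p hp h
    exact hp (by simpa [EuclideanIsometry.toFun] using h)
  frame_SU2 p := mul_mem hK (a.frame_SU2 _)
  frame_periodic t x := by rw [EuclideanIsometry.periodic a.frame_periodic]
  frame_radial t x s hs := by
    simp only [EuclideanIsometry.toFun, map_smul, a.frame_radial _ _ s hs]

lemma pullback_equiv (E : EuclideanIsometry) {K : Mat} (hK : K ∈ SU2) {a b : FramedConnection μ₀}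
    (h : GaugeEquiv a b) : GaugeEquiv (a.pullback E K hK) (b.pullback E K hK) := by
  obtain ⟨g, hs, hU, hp, hA, hl⟩ := h
  refine ⟨g ∘ E.toFun, hs.comp E.contDiff, fun p => hU _, EuclideanIsometry.periodic hp E, ?_, ?_⟩
  · intro p v
    have := ((hs.differentiable (by simp)) (E.toFun p)).hasFDerivAt.comp p (E.hasFDerivAt p)
    rw [this.fderiv]
    exact hA (E.toFun p) (E.lin v)
  · have := ((hl.comp E.tendsto_spatialInfinity).const_mul K).mul_const (star K)
    rw [mul_one, mul_star_of_SU2 hK] at this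
    refine this.congr fun p => ?_
    simp [pullback, star_mul, mul_assoc]

/-- `pullback` as a bijection. -/
def pullbackEquiv (E : EuclideanIsometry) (K : Mat) (hK : K ∈ SU2) :
    FramedConnection μ₀ ≃ FramedConnection μ₀ where
  toFun := pullback E K hK
  invFun := pullback E.inv (star K) (star_mem_SU2 hK)
  left_inv a := by
    apply FramedConnection.ext
    · funext p
      refine ContinuousLinearMap.ext fun v => ?_
      simp [pullback, E.toFun_inv, E.lin_inv]
    · funext p
      simp [pullback, ← mul_assoc, star_mul_of_SU2 hK, E.toFun_inv]
  right_inv a := by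
    apply FramedConnection.ext
    · funext p
      refine ContinuousLinearMap.ext fun v => ?_
      simp [pullback, E.inv_toFun, E.inv_lin]
    · funext p
      simp [pullback, ← mul_assoc, mul_star_of_SU2 hK, E.inv_toFun]

end FramedConnection

/-- The large gauge transformation `c(t) = diag(e^{iμ₀t/2}, e^{-iμ₀t/2})`, which is
anti-periodic, `c(t + 2π/μ₀) = -c(t)`. -/
def largeGauge (μ₀ : ℝ) (p : Spacetime) : Mat := diagPhase (μ₀ / 2 * p.1)

/-- The logarithmic derivative `(dc/dt) c⁻¹ = diag(iμ₀/2, -iμ₀/2)` of `largeGauge`. -/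
def largeGaugeLog (μ₀ : ℝ) : Mat :=
  Mat.of <| Matrix.diagonal ![Complex.I * (μ₀ / 2), -(Complex.I * (μ₀ / 2))]

lemma diagPhase_add (α β : ℝ) : diagPhase (α + β) = diagPhase α * diagPhase β := by
  refine Eq.trans ?_ (Matrix.diagonal_mul_diagonal _ _).symm
  simp only [diagPhase, Mat.of]
  congr 1
  ext i
  fin_cases i <;> simp [← Complex.exp_add] <;> ring_nf

lemma diagPhase_zero : diagPhase 0 = 1 := by
  refine Eq.trans ?_ Matrix.diagonal_one
  simp only [diagPhase, Mat.of]
  congr 1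
  ext i
  fin_cases i <;> simp

lemma diagPhase_pi : diagPhase Real.pi = -1 := by
  have : Matrix.diagonal ![Complex.exp (Complex.I * Real.pi),
      Complex.exp (-(Complex.I * Real.pi))] = (-1 : Matrix (Fin 2) (Fin 2) ℂ) := by
    ext i j
    fin_cases i <;> fin_cases j <;> simp [mul_comm Complex.I, Complex.exp_neg]
  exact this

lemma star_diagPhase (α : ℝ) : star (diagPhase α) = diagPhase (-α) := by
  have h : diagPhase (-α) * diagPhase α = 1 := by
    rw [← diagPhase_add, neg_add_cancel, diagPhase_zero]
  calc star (diagPhase α) = diagPhase (-α) * diagPhase α * star (diagPhase α) := by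
        rw [h, one_mul]
    _ = diagPhase (-α) := by rw [mul_assoc, mul_star_of_SU2 (diagPhase_mem α), mul_one]

lemma swap_mul_diagPhase (α : ℝ) : swap * diagPhase α = diagPhase (-α) * swap := by
  have : (!![0, 1; -1, 0] : Matrix (Fin 2) (Fin 2) ℂ) *
      Matrix.diagonal ![Complex.exp (Complex.I * α), Complex.exp (-(Complex.I * α))] =
      Matrix.diagonal ![Complex.exp (Complex.I * (-α : ℝ)),
        Complex.exp (-(Complex.I * (-α : ℝ)))] * !![0, 1; -1, 0] := by
    ext i j
    fin_cases i <;> fin_cases j <;> simp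
  exact this

lemma swap_mul_swap : swap * swap = -1 := by
  have : (!![0, 1; -1, 0] : Matrix (Fin 2) (Fin 2) ℂ) * !![0, 1; -1, 0] = -1 := by
    ext i j
    fin_cases i <;> fin_cases j <;> simp
  exact this

lemma largeGaugeLog_su2 (μ₀ : ℝ) : IsSu2 (largeGaugeLog μ₀) := by
  refine ⟨?_, ?_⟩
  · have : (Matrix.diagonal ![Complex.I * (μ₀ / 2), -(Complex.I * (μ₀ / 2))]).conjTranspose =
        -(Matrix.diagonal ![Complex.I * (μ₀ / 2), -(Complex.I * (μ₀ / 2))] :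
          Matrix (Fin 2) (Fin 2) ℂ) := by
      ext i j
      fin_cases i <;> fin_cases j <;> simp
    exact this
  · refine (Matrix.trace_diagonal _).trans ?_
    simp

lemma diagPhase_eq (θ : ℝ) : diagPhase θ =
    Real.cos θ • (1 : Mat) + Real.sin θ • Mat.of (Matrix.diagonal ![Complex.I, -Complex.I]) := by
  have : Matrix.diagonal ![Complex.exp (Complex.I * θ), Complex.exp (-(Complex.I * θ))] =
      Real.cos θ • (1 : Matrix (Fin 2) (Fin 2) ℂ)
        + Real.sin θ • Matrix.diagonal ![Complex.I, -Complex.I] := by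
    have h1 : Complex.exp (Complex.I * θ) = Complex.cos θ + Complex.sin θ * Complex.I := by
      rw [mul_comm, Complex.exp_mul_I]
    have h2 : Complex.exp (-(Complex.I * θ)) = Complex.cos θ - Complex.sin θ * Complex.I := by
      rw [← mul_neg, mul_comm, Complex.exp_mul_I, Complex.cos_neg, Complex.sin_neg]; ring
    ext i j
    fin_cases i <;> fin_cases j <;> simp [h1, h2] <;> ring
  exact this

lemma largeGaugeLog_eq (μ₀ : ℝ) : largeGaugeLog μ₀ =
    (μ₀ / 2) • Mat.of (Matrix.diagonal ![Complex.I, -Complex.I]) := by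
  have : Matrix.diagonal ![Complex.I * (μ₀ / 2), -(Complex.I * (μ₀ / 2))] =
      (μ₀ / 2) • (Matrix.diagonal ![Complex.I, -Complex.I] : Matrix (Fin 2) (Fin 2) ℂ) := by
    ext i j
    fin_cases i <;> fin_cases j <;> (simp; try ring)
  exact this

lemma sigma_sq : Mat.of (Matrix.diagonal ![Complex.I, -Complex.I]) *
    Mat.of (Matrix.diagonal ![Complex.I, -Complex.I]) = -1 := by
  have : Matrix.diagonal ![Complex.I, -Complex.I] * Matrix.diagonal ![Complex.I, -Complex.I] =
      (-1 : Matrix (Fin 2) (Fin 2) ℂ) := by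
    ext i j
    fin_cases i <;> fin_cases j <;> simp
  exact this

lemma largeGauge_contDiff (μ₀ : ℝ) : ContDiff ℝ ∞ (largeGauge μ₀) := by
  unfold largeGauge
  simp only [diagPhase_eq]
  have h : ContDiff ℝ ∞ fun p : Spacetime => μ₀ / 2 * p.1 := contDiff_const.mul contDiff_fst
  exact ((Real.contDiff_cos.comp h).smul contDiff_const).add
    ((Real.contDiff_sin.comp h).smul contDiff_const)

lemma largeGauge_fderiv (μ₀ : ℝ) (p v : Spacetime) :
    fderiv ℝ (largeGauge μ₀) p v = v.1 • (largeGaugeLog μ₀ * largeGauge μ₀ p) := by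
  have h : HasFDerivAt (fun p : Spacetime => μ₀ / 2 * p.1)
      ((μ₀ / 2) • ContinuousLinearMap.fst ℝ ℝ Space) p :=
    (ContinuousLinearMap.fst ℝ ℝ Space).hasFDerivAt.const_mul (μ₀ / 2)
  have h' := (h.cos.smul_const (1 : Mat)).add
    (h.sin.smul_const (Mat.of (Matrix.diagonal ![Complex.I, -Complex.I])))
  have e : largeGauge μ₀ = (fun p : Spacetime => Real.cos (μ₀ / 2 * p.1) • (1 : Mat)) +
      fun p => Real.sin (μ₀ / 2 * p.1) • Mat.of (Matrix.diagonal ![Complex.I, -Complex.I]) := by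
    funext p; exact diagPhase_eq _
  rw [← e] at h'
  rw [h'.fderiv, largeGauge, diagPhase_eq, largeGaugeLog_eq]
  simp only [mul_add, smul_mul_assoc, mul_smul_comm, mul_one, sigma_sq]
  simp only [add_apply, ContinuousLinearMap.smulRight_apply, smul_apply,
    ContinuousLinearMap.coe_fst', smul_eq_mul]
  module

lemma largeGauge_period (μ₀ t : ℝ) (x : Space) :
    largeGauge μ₀ (t + period μ₀, x) = largeGauge μ₀ (t, x) ∨
      largeGauge μ₀ (t + period μ₀, x) = -largeGauge μ₀ (t, x) := by
  simp only [largeGauge, mul_add, diagPhase_add]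
  by_cases h : μ₀ = 0
  · left; simp [h, diagPhase_zero]
  · right
    rw [show μ₀ / 2 * period μ₀ = Real.pi by unfold period; field_simp, diagPhase_pi]
    simp

lemma largeGauge_conj_period (μ₀ t : ℝ) (x : Space) (X : Mat) :
    largeGauge μ₀ (t + period μ₀, x) * X * star (largeGauge μ₀ (t + period μ₀, x)) =
      largeGauge μ₀ (t, x) * X * star (largeGauge μ₀ (t, x)) := by
  rcases largeGauge_period μ₀ t x with h | h <;> simp [h]

lemma largeGauge_mem (μ₀ : ℝ) (p : Spacetime) : largeGauge μ₀ p ∈ SU2 := diagPhase_mem _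

lemma diagPhase_norm_le : ∃ C : ℝ, ∀ θ, ‖diagPhase θ‖ ≤ C := by
  refine ⟨‖(1 : Mat)‖ + ‖Mat.of (Matrix.diagonal ![Complex.I, -Complex.I])‖, fun θ => ?_⟩
  rw [diagPhase_eq]
  refine (norm_add_le _ _).trans (add_le_add ?_ ?_) <;> rw [norm_smul]
  · exact mul_le_of_le_one_left (norm_nonneg _) (Real.abs_cos_le_one θ)
  · exact mul_le_of_le_one_left (norm_nonneg _) (Real.abs_sin_le_one θ)

lemma tendsto_conj_diagPhase {l : Filter Spacetime} {X : Spacetime → Mat} (θ : Spacetime → ℝ)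
    (h : Tendsto X l (𝓝 1)) :
    Tendsto (fun p => diagPhase (θ p) * X p * star (diagPhase (θ p))) l (𝓝 1) := by
  obtain ⟨C, hC⟩ := diagPhase_norm_le
  have hC0 : 0 ≤ C := (norm_nonneg _).trans (hC 0)
  have h0 := tendsto_iff_norm_sub_tendsto_zero.1 h
  refine tendsto_iff_norm_sub_tendsto_zero.2 ?_
  refine squeeze_zero (fun p => norm_nonneg _) (g := fun p => C * ‖X p - 1‖ * C) (fun p => ?_) ?_
  · have : diagPhase (θ p) * X p * star (diagPhase (θ p)) - 1 =
        diagPhase (θ p) * (X p - 1) * star (diagPhase (θ p)) := by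
      rw [mul_sub, sub_mul, mul_one, mul_star_of_SU2 (diagPhase_mem _)]
    rw [this]
    refine (norm_mul_le _ _).trans (mul_le_mul ((norm_mul_le _ _).trans ?_) ?_ (norm_nonneg _) ?_)
    · exact mul_le_mul_of_nonneg_right (hC _) (norm_nonneg _)
    · rw [star_diagPhase]; exact hC _
    · positivity
  · simpa using (h0.const_mul C).mul_const C

namespace FramedConnection

variable {μ₀ : ℝ}

/-- The rotation map on framed connections. The connection `A` becomes its transform
`c A c⁻¹ - dc c⁻¹` under the large gauge transformation `c`, and the framing `f` becomes
`c f c⁻¹`; up to a periodic gauge transformation this is the large gauge transformation of `A`, with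
the framing kept, by any `σ` with `σ(t + 2π/μ₀) = -σ(t)` and `f σ f⁻¹ = e^{±iμ₀t/2}` on
`L_±` at infinity. It turns the boundary value `Φ_∞ dt` into `-Φ_∞ dt`, that is, it exchanges the
roles of `L_+` and `L_-`; the final `swap` identifies the result with a connection framed
by the original data `Φ_∞`. -/
def rotate (a : FramedConnection μ₀) : FramedConnection μ₀ where
  conn p := (ContinuousLinearMap.mulLeftRight ℝ Mat (largeGauge μ₀ p)
      (star (largeGauge μ₀ p))).comp (a.conn p)
    - (ContinuousLinearMap.fst ℝ ℝ Space).smulRight (largeGaugeLog μ₀)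
  frame p := swap * (largeGauge μ₀ p * a.frame p * star (largeGauge μ₀ p))
  conn_smooth := by
    refine ContDiff.sub (ContDiff.clm_comp ?_ a.conn_smooth) contDiff_const
    exact ((ContinuousLinearMap.mulLeftRight ℝ Mat).contDiff.comp
      (largeGauge_contDiff μ₀)).clm_apply (contDiff_star (largeGauge_contDiff μ₀))
  conn_su2 p v := ((a.conn_su2 p v).conj (largeGauge_mem μ₀ p)).sub
    ((largeGaugeLog_su2 μ₀).smul v.1)
  conn_periodic t x := by
    refine ContinuousLinearMap.ext fun v => ?_
    simp [a.conn_periodic, largeGauge_conj_period]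
  frame_smooth := contDiffOn_const.mul (((largeGauge_contDiff μ₀).contDiffOn.mul
    a.frame_smooth).mul (contDiff_star (largeGauge_contDiff μ₀)).contDiffOn)
  frame_SU2 p := mul_mem swap_mem (mul_mem (mul_mem (largeGauge_mem μ₀ p) (a.frame_SU2 p))
    (star_mem_SU2 (largeGauge_mem μ₀ p)))
  frame_periodic t x := by rw [largeGauge_conj_period, a.frame_periodic]
  frame_radial t x s hs := by
    rw [a.frame_radial t x s hs]; rfl

lemma rotate_conn (a : FramedConnection μ₀) (p v : Spacetime) : a.rotate.conn p v =
    largeGauge μ₀ p * a.conn p v * star (largeGauge μ₀ p) - v.1 • largeGaugeLog μ₀ := by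
  simp [rotate]

/-- The rotation map is the gauge transformation by the anti-periodic map `c`. -/
lemma rotate_gaugeTakes (a : FramedConnection μ₀) :
    GaugeTakes (largeGauge μ₀) a.conn a.rotate.conn := by
  intro p v
  rw [rotate_conn, largeGauge_fderiv, smul_mul_assoc, mul_assoc (largeGaugeLog μ₀),
    mul_star_of_SU2 (largeGauge_mem μ₀ p), mul_one]

lemma rotate_equiv {a b : FramedConnection μ₀} (h : GaugeEquiv a b) :
    GaugeEquiv a.rotate b.rotate := by
  obtain ⟨g, hs, hU, hp, hA, hl⟩ := h
  have hc := largeGauge_contDiff μ₀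
  have cU := largeGauge_mem μ₀
  have gU : ∀ p, largeGauge μ₀ p * g p * star (largeGauge μ₀ p) ∈ SU2 := fun p =>
    mul_mem (mul_mem (cU p) (hU p)) (star_mem_SU2 (cU p))
  refine ⟨fun p => largeGauge μ₀ p * g p * star (largeGauge μ₀ p),
    (hc.mul hs).mul (contDiff_star hc), gU, fun t x => ?_, ?_, ?_⟩
  · simp only [hp, largeGauge_conj_period]
  · rw [gaugeTakes_iff gU]
    intro p v
    have ha := (gaugeTakes_iff cU).1 a.rotate_gaugeTakes p v
    have hb := (gaugeTakes_iff cU).1 b.rotate_gaugeTakes p v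
    have hg := (gaugeTakes_iff hU).1 hA p v
    rw [fderiv_mul_mat (hc.mul hs) (contDiff_star hc), fderiv_mul_mat hc hs,
      fderiv_star_mat hc, hg]
    nth_rewrite 1 [ha]
    rw [hb]
    simp only [star_sub, star_mul, (a.conn_su2 p v).1, (a.rotate.conn_su2 p v).1]
    noncomm_ring
  · have h1 := ((tendsto_conj_diagPhase (fun p => μ₀ / 2 * p.1) hl).const_mul swap).mul_const
      (star swap)
    rw [mul_one, mul_star_of_SU2 swap_mem] at h1
    refine h1.congr fun p => ?_
    change swap * (largeGauge μ₀ p * (b.frame p * g p * star (a.frame p)) *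
      star (largeGauge μ₀ p)) * star swap = swap * (largeGauge μ₀ p * b.frame p *
        star (largeGauge μ₀ p)) * (largeGauge μ₀ p * g p * star (largeGauge μ₀ p)) *
        star (swap * (largeGauge μ₀ p * a.frame p * star (largeGauge μ₀ p)))
    have e := star_mul_of_SU2 (cU p)
    simp only [star_mul, star_star, mul_assoc]
    rw [← mul_assoc (star (largeGauge μ₀ p)) (largeGauge μ₀ p), e, one_mul,
      ← mul_assoc (star (largeGauge μ₀ p)) (largeGauge μ₀ p), e, one_mul]

lemma rotate_rotate (a : FramedConnection μ₀) : GaugeEquiv a a.rotate.rotate := by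
  have hc := largeGauge_contDiff μ₀
  have cU := largeGauge_mem μ₀
  have ncU : ∀ p, -largeGauge μ₀ p ∈ SU2 := fun p => by
    rw [← one_mul (largeGauge μ₀ p), ← neg_mul, ← diagPhase_pi]
    exact mul_mem (diagPhase_mem _) (cU p)
  have gU : ∀ p, -largeGauge μ₀ p * largeGauge μ₀ p ∈ SU2 := fun p => mul_mem (ncU p) (cU p)
  refine ⟨fun p => -largeGauge μ₀ p * largeGauge μ₀ p, hc.neg.mul hc, gU, fun t x => ?_, ?_, ?_⟩
  · rcases largeGauge_period μ₀ t x with h | h <;> simp [h]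
  · rw [gaugeTakes_iff gU]
    intro p v
    have h1 := (gaugeTakes_iff cU).1 a.rotate_gaugeTakes p v
    have h2 := (gaugeTakes_iff cU).1 a.rotate.rotate_gaugeTakes p v
    rw [fderiv_mul_mat hc.neg hc]
    have h3 : fderiv ℝ (fun p => -largeGauge μ₀ p) p v = -fderiv ℝ (largeGauge μ₀) p v := by
      rw [fderiv_fun_neg]; simp
    rw [h3, h2]
    nth_rewrite 1 [← h2]
    rw [h1]
    noncomm_ring
  · refine tendsto_const_nhds.congr fun p => ?_
    change 1 = swap * (largeGauge μ₀ p * (swap * (largeGauge μ₀ p * a.frame p *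
      star (largeGauge μ₀ p))) * star (largeGauge μ₀ p)) * (-largeGauge μ₀ p * largeGauge μ₀ p) *
        star (a.frame p)
    have e := star_mul_of_SU2 (cU p)
    have e1 : swap * largeGauge μ₀ p = star (largeGauge μ₀ p) * swap := by
      rw [largeGauge, star_diagPhase, swap_mul_diagPhase]
    have e2 : swap * (largeGauge μ₀ p * (swap * (largeGauge μ₀ p * a.frame p *
        star (largeGauge μ₀ p))) * star (largeGauge μ₀ p)) * (-largeGauge μ₀ p * largeGauge μ₀ p) *
        star (a.frame p) = -((swap * largeGauge μ₀ p) * (swap * largeGauge μ₀ p) * a.frame p *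
        star (largeGauge μ₀ p) * (star (largeGauge μ₀ p) * largeGauge μ₀ p) * largeGauge μ₀ p *
        star (a.frame p)) := by noncomm_ring
    have e3 : (swap * largeGauge μ₀ p) * (swap * largeGauge μ₀ p) = -1 := by
      nth_rewrite 2 [e1]
      rw [mul_assoc, ← mul_assoc (largeGauge μ₀ p), mul_star_of_SU2 (cU p), one_mul, swap_mul_swap]
    rw [e2, e3, e, mul_one, mul_assoc _ (star (largeGauge μ₀ p)), e, mul_one, neg_one_mul, neg_mul,
      mul_star_of_SU2 (a.frame_SU2 p), neg_neg]

end FramedConnection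

/-- The transformation of the moduli space induced by `pullbackEquiv`. -/
def pullbackPerm (μ₀ : ℝ) (E : EuclideanIsometry) (K : Mat) (hK : K ∈ SU2) :
    Equiv.Perm (ModuliSpace μ₀) :=
  Quotient.congr (FramedConnection.pullbackEquiv E K hK) fun a b =>
    ⟨fun h => FramedConnection.pullback_equiv E hK h, fun h => by
      have h' := FramedConnection.pullback_equiv E.inv (star_mem_SU2 hK) h
      have e : ∀ c : FramedConnection μ₀, (FramedConnection.pullbackEquiv E K hK c).pullback E.inv
          (star K) (star_mem_SU2 hK) = c := (FramedConnection.pullbackEquiv E K hK).left_inv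
      rw [e, e] at h'
      exact h'⟩

/-- The phase `P(θ)`: the framing is multiplied by `e^{±iθ}` on `L_±`. Up to a gauge transformation
this is the action on the connection, with the framing kept, of any automorphism of `V` equal to
`e^{±iθ}` on `L_±` at infinity. -/
def phase (μ₀ θ : ℝ) : Equiv.Perm (ModuliSpace μ₀) :=
  pullbackPerm μ₀ EuclideanIsometry.id (diagPhase θ) (diagPhase_mem θ)

/-- The action of `(O(2) × O(3))₊` by pull-back. An isometry that reverses the circle turns
`Φ_∞ dt` into `-Φ_∞ dt`, and is followed by the exchange of `L_+` and `L_-`. -/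
def euclidean (μ₀ : ℝ) (E : EuclideanIsometry) : Equiv.Perm (ModuliSpace μ₀) :=
  if E.sign = 1 then pullbackPerm μ₀ E 1 (one_mem _) else pullbackPerm μ₀ E swap swap_mem

/-- The rotation map `ρ`, an involution of the moduli space. -/
def rotation (μ₀ : ℝ) : Equiv.Perm (ModuliSpace μ₀) :=
  Function.Involutive.toPerm
    (Quotient.map FramedConnection.rotate fun _ _ h => FramedConnection.rotate_equiv h) fun x =>
      Quotient.inductionOn x fun a => Quotient.sound (FramedConnection.rotate_rotate a).symm

/-- The symmetry group `𝒮`, generated by the euclidean symmetries, the phases and the rotation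
map. -/
def symmetryGroup (μ₀ : ℝ) : Subgroup (Equiv.Perm (ModuliSpace μ₀)) :=
  Subgroup.closure (Set.range (euclidean μ₀) ∪ Set.range (phase μ₀) ∪ {rotation μ₀})

/-- The set `𝒞_k(H)` of `H`-symmetric `(k,k)`-calorons. -/
def symmetricCalorons (μ₀ : ℝ) (k : ℕ) (H : Subgroup (Equiv.Perm (ModuliSpace μ₀))) :
    Set (ModuliSpace μ₀) :=
  {x | x ∈ calorons μ₀ k ∧ ∀ h ∈ H, h x = x}

end Caloron

end

noncomputable section

namespace Caloron


/-! ### Linear algebra in `su(2)` -/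

/-! Being fixed by P(θ)ρ forces a reduction of the connection, strong enough to make the charge
vanish. The phase changes only the framing, so a fixed class has a periodic gauge transformation g
taking A to its transform under the anti-periodic c. Hence h = c⁻¹g satisfies d_A h = 0, takes
values in SU(2) and changes sign around the circle (`exists_parallel_of_fixed`). Its trace is
constant and odd, hence zero (`trace_eq_zero_of_parallel`), so h is skew-hermitian with h² = -1.

The curvature commutes with h (`curvature_comm_of_parallel`). Since both lie in su(2), F is
determined by the scalar two-form tr(Fh), which is closed by the Bianchi identity and anti-self-dual
because F is. Its electric components therefore solve a Maxwell-type system and are harmonic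
functions (`laplacian_traceForm`), periodic with twice the period.

The smooth extension of A to the radial compactification bounds the curvature there. Pulling a fixed
spatial vector back to the ball shrinks it by a factor O(1/r), so F_{0i} = O(1/r)
(`tendsto_curvature`). A harmonic function on S¹ × ℝ³ vanishing at spatial infinity is zero by the
maximum principle (`eq_zero_of_harmonic`). So tr(F_{0i}h) = 0: F_{0i} then both commutes and
anticommutes with the invertible h, and vanishes (`curvComp_eq_zero`). Every term of tr(F ∧ F) has a
factor F_{0i}, so the charge is 0, contradicting k ≥ 1. -/

instance : FiniteDimensional ℝ Mat :=
  inferInstanceAs (FiniteDimensional ℝ (Matrix (Fin 2) (Fin 2) ℂ))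

lemma Mat.trace_add (X Y : Mat) : (X + Y).trace = X.trace + Y.trace :=
  Matrix.trace_add (X : Matrix (Fin 2) (Fin 2) ℂ) Y

lemma Mat.trace_star (X : Mat) : (star X).trace = star X.trace :=
  Matrix.trace_conjTranspose (X : Matrix (Fin 2) (Fin 2) ℂ)

/-- The trace as a continuous linear map. -/
def traceCLM : Mat →L[ℝ] ℂ :=
  LinearMap.toContinuousLinearMap
    { toFun := Mat.trace, map_add' := Mat.trace_add, map_smul' := Mat.trace_smul }

@[simp] lemma traceCLM_apply (X : Mat) : traceCLM X = X.trace := rfl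

/-- Polarized Cayley–Hamilton: XY + YX = tr(XY)·1 for trace-free X and Y. -/
lemma matrix_anticomm_of_trace_eq_zero {X Y : Matrix (Fin 2) (Fin 2) ℂ} (hX : X.trace = 0)
    (hY : Y.trace = 0) (hXY : (X * Y).trace = 0) : X * Y + Y * X = 0 := by
  simp only [Matrix.trace_fin_two, Matrix.mul_apply, Fin.sum_univ_two] at hX hY hXY
  ext i j
  fin_cases i <;> fin_cases j <;>
    simp only [Matrix.add_apply, Matrix.mul_apply, Fin.sum_univ_two, Matrix.zero_apply,
      Fin.zero_eta, Fin.mk_one, Fin.isValue]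
  · linear_combination hXY + X 0 0 * hY - Y 1 1 * hX
  · linear_combination X 0 1 * hY + Y 0 1 * hX
  · linear_combination X 1 0 * hY + Y 1 0 * hX
  · linear_combination hXY - X 0 0 * hY + Y 1 1 * hX

/-- Anticommutators of trace-free matrices are scalar; in particular, orthogonal trace-free matrices
anticommute. -/
lemma anticomm_of_trace_eq_zero {X Y : Mat} (hX : X.trace = 0) (hY : Y.trace = 0)
    (hXY : (X * Y).trace = 0) : X * Y + Y * X = 0 :=
  matrix_anticomm_of_trace_eq_zero hX hY hXY

/-- Cayley–Hamilton, X² = tr(X) X - det(X), checked entry by entry. -/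
lemma matrix_mul_neg_self {X : Matrix (Fin 2) (Fin 2) ℂ} (ht : X.trace = 0) (hd : X.det = 1) :
    X * -X = 1 := by
  rw [Matrix.trace_fin_two] at ht
  rw [Matrix.det_fin_two] at hd
  ext i j
  fin_cases i <;> fin_cases j <;>
    simp [Matrix.mul_apply, Fin.sum_univ_two]
  · linear_combination hd - X 0 0 * ht
  · linear_combination - X 0 1 * ht
  · linear_combination - X 1 0 * ht
  · linear_combination hd - X 1 1 * ht

/-- A trace-free element of `SU(2)` is skew-hermitian. -/
lemma star_eq_neg_of_SU2 {g : Mat} (hg : g ∈ SU2) (ht : g.trace = 0) : star g = -g :=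
  left_inv_eq_right_inv (star_mul_of_SU2 hg)
    (matrix_mul_neg_self ht (Matrix.mem_specialUnitaryGroup_iff.1 hg).2)

/-! ### Partial derivatives and the maximum principle -/

/-- The partial derivative along a coordinate vector field. -/
def partialDeriv (i : Fin 4) (u : Spacetime → ℝ) (p : Spacetime) : ℝ := fderiv ℝ u p (basisVec i)

lemma contDiff_fderiv_apply {E : Type*} [NormedAddCommGroup E] [NormedSpace ℝ E]
    {u : Spacetime → E} (hu : ContDiff ℝ ∞ u) (v : Spacetime) :
    ContDiff ℝ ∞ fun p => fderiv ℝ u p v :=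
  (hu.fderiv_right (m := ∞) le_rfl).clm_apply contDiff_const

lemma fderiv_fderiv_apply {E : Type*} [NormedAddCommGroup E] [NormedSpace ℝ E]
    {u : Spacetime → E} (hu : ContDiff ℝ ∞ u) (p v w : Spacetime) :
    fderiv ℝ (fun p => fderiv ℝ u p v) p w = fderiv ℝ (fderiv ℝ u) p w v := by
  have h := (((hu.fderiv_right (m := ∞) le_rfl).differentiable (by simp)) p).hasFDerivAt.clm_apply
    (hasFDerivAt_const v p)
  rw [h.fderiv]
  simp

lemma fderiv_fderiv_symm {E : Type*} [NormedAddCommGroup E] [NormedSpace ℝ E]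
    {u : Spacetime → E} (hu : ContDiff ℝ ∞ u) (p v w : Spacetime) :
    fderiv ℝ (fderiv ℝ u) p v w = fderiv ℝ (fderiv ℝ u) p w v :=
  (hu.contDiffAt.isSymmSndFDerivAt (by simpa using WithTop.coe_le_coe.2 (le_top : (2 : ℕ∞) ≤ ⊤))).eq
    v w

lemma partialDeriv_comm {u : Spacetime → ℝ} (hu : ContDiff ℝ ∞ u) (i j : Fin 4) :
    partialDeriv i (partialDeriv j u) = partialDeriv j (partialDeriv i u) := by
  funext p
  exact (fderiv_fderiv_apply hu p _ _).trans
    ((fderiv_fderiv_symm hu p _ _).trans (fderiv_fderiv_apply hu p _ _).symm)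

lemma contDiff_partialDeriv {u : Spacetime → ℝ} (hu : ContDiff ℝ ∞ u) (i : Fin 4) :
    ContDiff ℝ ∞ (partialDeriv i u) := contDiff_fderiv_apply hu _

lemma partialDeriv_add {u v : Spacetime → ℝ} (hu : ContDiff ℝ ∞ u) (hv : ContDiff ℝ ∞ v)
    (i : Fin 4) : partialDeriv i (fun p => u p + v p) =
      fun p => partialDeriv i u p + partialDeriv i v p := by
  funext p
  simp only [partialDeriv]
  rw [fderiv_fun_add (hu.differentiable (by simp) p) (hv.differentiable (by simp) p)]
  simp

lemma partialDeriv_neg (u : Spacetime → ℝ) (i : Fin 4) :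
    partialDeriv i (fun p => -u p) = fun p => -partialDeriv i u p := by
  funext p
  simp only [partialDeriv]
  rw [fderiv_fun_neg]
  simp

lemma partialDeriv_sub {u v : Spacetime → ℝ} (hu : ContDiff ℝ ∞ u) (hv : ContDiff ℝ ∞ v)
    (i : Fin 4) : partialDeriv i (fun p => u p - v p) =
      fun p => partialDeriv i u p - partialDeriv i v p := by
  funext p
  simp only [partialDeriv]
  rw [fderiv_fun_sub (hu.differentiable (by simp) p) (hv.differentiable (by simp) p)]
  simp

/-- A positive second derivative would make x a local minimum as well, so f would be locally
constant and its second derivative zero. -/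
lemma deriv_deriv_nonpos_of_isLocalMax {f : ℝ → ℝ} {x : ℝ} (hf : ContinuousAt f x)
    (h : IsLocalMax f x) : deriv (deriv f) x ≤ 0 := by
  by_contra! hpos
  have hmin := isLocalMin_of_deriv_deriv_pos hpos h.deriv_eq_zero hf
  have he : f =ᶠ[𝓝 x] fun _ => f x := by
    filter_upwards [h, hmin] with y h1 h2 using le_antisymm h1 h2
  rw [he.deriv.deriv_eq] at hpos
  simp at hpos

lemma partialDeriv_partialDeriv_nonpos {u : Spacetime → ℝ} (hu : ContDiff ℝ ∞ u) {p : Spacetime}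
    (h : IsLocalMax u p) (i : Fin 4) : partialDeriv i (partialDeriv i u) p ≤ 0 := by
  -- Needed for general w because it is applied twice, to u and to its partial derivative.
  have hline : ∀ (w : Spacetime → ℝ), ContDiff ℝ ∞ w → ∀ s : ℝ,
      deriv (fun s : ℝ => w (p + s • basisVec i)) s = partialDeriv i w (p + s • basisVec i) := by
    intro w hw s
    have h1 : HasDerivAt (fun s : ℝ => p + s • basisVec i) (basisVec i) s := by
      simpa using ((hasDerivAt_id s).smul_const (basisVec i)).const_add p
    exact ((hw.differentiable (by simp) _).hasFDerivAt.comp_hasDerivAt s h1).deriv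
  have hc : Continuous fun s : ℝ => p + s • basisVec i := by fun_prop
  have h0 : p + (0 : ℝ) • basisVec i = p := by simp
  have hmax : IsLocalMax (fun s : ℝ => u (p + s • basisVec i)) 0 := by
    have := hc.tendsto 0
    rw [h0] at this
    have h2 := this.eventually h
    simpa only [IsLocalMax, IsMaxFilter, h0] using h2
  have : deriv (deriv fun s : ℝ => u (p + s • basisVec i)) 0 ≤ 0 :=
    deriv_deriv_nonpos_of_isLocalMax (hu.continuous.comp hc).continuousAt hmax
  rw [show deriv (fun s : ℝ => u (p + s • basisVec i)) =
    fun s => partialDeriv i u (p + s • basisVec i) from funext (hline u hu),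
    hline _ (contDiff_partialDeriv hu i), h0] at this
  exact this

lemma basisVec_zero : basisVec 0 = ((1 : ℝ), (0 : Space)) := rfl

lemma basisVec_one : basisVec 1 = ((0 : ℝ), EuclideanSpace.single (0 : Fin 3) (1 : ℝ)) := rfl

lemma basisVec_two : basisVec 2 = ((0 : ℝ), EuclideanSpace.single (1 : Fin 3) (1 : ℝ)) := rfl

lemma basisVec_three : basisVec 3 = ((0 : ℝ), EuclideanSpace.single (2 : Fin 3) (1 : ℝ)) := rfl

/-- The flat Laplacian. -/
def laplacian (u : Spacetime → ℝ) (p : Spacetime) : ℝ :=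
  ∑ i : Fin 4, partialDeriv i (partialDeriv i u) p

/-- This perturbation makes a harmonic function strictly subharmonic, as the maximum principle
requires; one coordinate is enough. The index `0` counts inside ℝ³, so the direction is `basisVec
1`. -/
lemma laplacian_coord_sq (ε : ℝ) (p : Spacetime) :
    laplacian (fun p => ε * p.2 0 ^ 2) p = 2 * ε := by
  let ℓ : Spacetime →L[ℝ] ℝ :=
    (EuclideanSpace.proj (0 : Fin 3)).comp (ContinuousLinearMap.snd ℝ ℝ Space)
  have hℓ : ∀ p : Spacetime, HasFDerivAt (fun p : Spacetime => p.2 0) ℓ p := fun p => ℓ.hasFDerivAt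
  have h1 : ∀ i, partialDeriv i (fun p => ε * p.2 0 ^ 2) =
      fun p => (2 * ε * ℓ (basisVec i)) * p.2 0 := by
    intro i
    funext p
    rw [partialDeriv, (((hℓ p).pow 2).const_mul ε).fderiv]
    simp
    ring
  have h2 : ∀ i, partialDeriv i (partialDeriv i (fun p => ε * p.2 0 ^ 2)) p =
      2 * ε * ℓ (basisVec i) * ℓ (basisVec i) := by
    intro i
    rw [h1, partialDeriv, ((hℓ p).const_mul _).fderiv]
    simp
  simp [laplacian, h2, Fin.sum_univ_four, basisVec_zero, basisVec_one, basisVec_two, basisVec_three,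
    ℓ]

/-- If u takes a value m > 0, then u + ε(x¹)² has an interior maximum in a solid cylinder |x| ≤ R
beyond which u < m/2. Its Laplacian there would be both nonpositive and equal to 2ε > 0. -/
lemma nonpos_of_harmonic {u : Spacetime → ℝ} (hu : ContDiff ℝ ∞ u) {T : ℝ} (hT : 0 < T)
    (hper : ∀ t x, u (t + T, x) = u (t, x)) (hΔ : ∀ p, laplacian u p = 0)
    (hlim : Tendsto u spatialInfinity (𝓝 0)) (p₀ : Spacetime) : u p₀ ≤ 0 := by
  by_contra! hpos
  set m := u p₀ with hm
  obtain ⟨R, hR⟩ : ∃ R : ℝ, ∀ p : Spacetime, R ≤ ‖p.2‖ → u p < m / 2 := by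
    have := hlim.eventually (gt_mem_nhds (half_pos hpos))
    rw [spatialInfinity, eventually_comap] at this
    obtain ⟨R, hR⟩ := eventually_atTop.1 this
    exact ⟨R, fun p hp => hR _ hp p rfl⟩
  -- Small enough that the perturbation stays below m/2 for |x| ≤ R; the summand 1 keeps the
  -- denominator positive.
  set ε : ℝ := m / (2 * (R ^ 2 + 1)) with hε
  have hε0 : 0 < ε := by positivity
  have hεR : ε * R ^ 2 ≤ m / 2 := by
    rw [hε, div_mul_eq_mul_div, div_le_div_iff₀ (by positivity) (by positivity)]
    nlinarith
  let v : Spacetime → ℝ := fun p => u p + ε * p.2 0 ^ 2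
  have hq : ContDiff ℝ ∞ fun p : Spacetime => ε * p.2 0 ^ 2 := by
    have : ContDiff ℝ ∞ fun p : Spacetime => p.2 0 :=
      ((EuclideanSpace.proj (0 : Fin 3)).comp (ContinuousLinearMap.snd ℝ ℝ Space)).contDiff
    exact contDiff_const.mul (this.pow 2)
  have hv : ContDiff ℝ ∞ v := hu.add hq
  have hvper : ∀ (n : ℤ) t x, v (t + n • T, x) = v (t, x) := by
    intro n t x
    have : Function.Periodic (fun t => v (t, x)) T := fun t => by simp only [v, hper]
    exact this.zsmul n t
  let K : Set Spacetime := Set.Icc 0 T ×ˢ Metric.closedBall 0 R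
  have hK : IsCompact K := isCompact_Icc.prod (isCompact_closedBall _ _)
  -- Periodicity makes a maximum over the compact `K` a maximum over the whole solid cylinder, so a
  -- maximizer with t = 0 or t = T causes no boundary problem.
  have hred : ∀ p : Spacetime, ‖p.2‖ ≤ R → ∃ q ∈ K, v q = v p := by
    intro p hp
    refine ⟨(toIcoMod hT 0 p.1, p.2), ⟨?_, by simpa using hp⟩, ?_⟩
    · have := toIcoMod_mem_Ico hT 0 p.1
      exact ⟨this.1, by simpa using this.2.le⟩
    · rw [toIcoMod, sub_eq_add_neg, ← neg_smul, hvper]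
  have hp₀R : ‖p₀.2‖ ≤ R := by
    by_contra! h
    have := hR p₀ h.le
    linarith
  obtain ⟨q₀, hq₀, hq₀'⟩ := hred p₀ hp₀R
  obtain ⟨q, hqK, hqmax⟩ := hK.exists_isMaxOn ⟨q₀, hq₀⟩ hv.continuous.continuousOn
  have hge : m ≤ v q := by
    have h1 : v q₀ ≤ v q := hqmax hq₀
    have h2 : v p₀ = m + ε * p₀.2 0 ^ 2 := rfl
    nlinarith [sq_nonneg (p₀.2 0), mul_nonneg hε0.le (sq_nonneg (p₀.2 0))]
  have hqR : ‖q.2‖ ≤ R := by simpa using hqK.2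
  -- On the sphere |x| = R the sum is below m/2 + m/2 = m, while the maximum is at least m.
  have hlt : ‖q.2‖ < R := by
    refine lt_of_le_of_ne hqR fun h => ?_
    have h1 := hR q h.ge
    have h2 : q.2 0 ^ 2 ≤ R ^ 2 := by
      rw [← h, ← sq_abs]
      exact pow_le_pow_left₀ (abs_nonneg _) (PiLp.norm_apply_le q.2 0) 2
    have h3 : v q = u q + ε * q.2 0 ^ 2 := rfl
    nlinarith [mul_le_mul_of_nonneg_left h2 hε0.le]
  have hloc : IsLocalMax v q := by
    have : ∀ᶠ p : Spacetime in 𝓝 q, ‖p.2‖ < R :=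
      (continuous_snd.norm.tendsto q).eventually (gt_mem_nhds hlt)
    filter_upwards [this] with p hp
    obtain ⟨p', hp', he⟩ := hred p hp.le
    rw [← he]
    exact hqmax hp'
  have hsum : laplacian v q ≤ 0 :=
    Finset.sum_nonpos fun i _ => partialDeriv_partialDeriv_nonpos hv hloc i
  have hadd : laplacian v q = laplacian u q + laplacian (fun p => ε * p.2 0 ^ 2) q := by
    simp only [laplacian, ← Finset.sum_add_distrib]
    refine Finset.sum_congr rfl fun i _ => ?_
    rw [show v = fun p => u p + ε * p.2 0 ^ 2 from rfl, partialDeriv_add hu hq,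
      partialDeriv_add (contDiff_partialDeriv hu i) (contDiff_partialDeriv hq i)]
  rw [hadd, hΔ, laplacian_coord_sq] at hsum
  linarith

/-- A smooth harmonic function on `S¹ × ℝ³` which vanishes at spatial infinity is zero. -/
lemma eq_zero_of_harmonic {u : Spacetime → ℝ} (hu : ContDiff ℝ ∞ u) {T : ℝ} (hT : 0 < T)
    (hper : ∀ t x, u (t + T, x) = u (t, x)) (hΔ : ∀ p, laplacian u p = 0)
    (hlim : Tendsto u spatialInfinity (𝓝 0)) (p : Spacetime) : u p = 0 := by
  refine le_antisymm (nonpos_of_harmonic hu hT hper hΔ hlim p) ?_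
  have := nonpos_of_harmonic hu.neg hT (fun t x => by rw [hper]) (fun p => ?_)
    (by simpa using hlim.neg) p
  · linarith
  · have h := hΔ p
    simp only [laplacian] at h ⊢
    simp only [partialDeriv_neg, Finset.sum_neg_distrib, h, neg_zero]


/-! ### Curvature -/

section Curvature

variable {A : Spacetime → Spacetime →L[ℝ] Mat}

lemma contDiff_curvature (hA : ContDiff ℝ ∞ A) (v w : Spacetime) :
    ContDiff ℝ ∞ fun p => curvature A p v w := by
  have h1 : ∀ v w, ContDiff ℝ ∞ fun p => fderiv ℝ A p v w := fun v w =>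
    (contDiff_fderiv_apply hA v).clm_apply contDiff_const
  have h2 : ∀ v, ContDiff ℝ ∞ fun p => A p v := fun v => hA.clm_apply contDiff_const
  exact ((h1 v w).sub (h1 w v)).add (((h2 v).mul (h2 w)).sub ((h2 w).mul (h2 v)))

lemma curvature_periodic {T : ℝ} (hA : ∀ t x, A (t + T, x) = A (t, x)) (t : ℝ) (x : Space)
    (v w : Spacetime) : curvature A (t + T, x) v w = curvature A (t, x) v w := by
  have h : fderiv ℝ A (t + T, x) = fderiv ℝ A (t, x) := by
    have e : (fun p : Spacetime => A (p + (T, 0))) = A := by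
      funext p
      rw [← hA p.1 p.2]
      congr 1
      ext1 <;> simp
    have := fderiv_comp_add_right (𝕜 := ℝ) (f := A) (x := (t, x)) ((T, 0) : Spacetime)
    rw [e] at this
    simpa using this.symm
  simp only [curvature, h, hA]

lemma curvature_antisymm (p v w : Spacetime) : curvature A p w v = -curvature A p v w := by
  simp only [curvature]; abel

lemma hasFDerivAt_conn_apply (hA : ContDiff ℝ ∞ A) (p v : Spacetime) :
    HasFDerivAt (fun p => A p v) ((fderiv ℝ A p).flip v) p := by
  have h := ((hA.differentiable (by simp)) p).hasFDerivAt.clm_apply (hasFDerivAt_const v p)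
  exact h.congr_fderiv (by simp)

lemma fderiv_curvature (hA : ContDiff ℝ ∞ A) (p u v w : Spacetime) :
    fderiv ℝ (fun p => curvature A p v w) p u =
      fderiv ℝ (fderiv ℝ A) p u v w - fderiv ℝ (fderiv ℝ A) p u w v +
      (A p v * fderiv ℝ A p u w + fderiv ℝ A p u v * A p w
        - (A p w * fderiv ℝ A p u v + fderiv ℝ A p u w * A p v)) := by
  have h1 : ∀ v w, HasFDerivAt (fun p => fderiv ℝ A p v w)
      (((fderiv ℝ (fderiv ℝ A) p).flip v).flip w) p := fun v w => by
    have h := (((hA.fderiv_right (m := ∞) le_rfl).differentiable (by simp)) p).hasFDerivAt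
    have h' := (h.clm_apply (hasFDerivAt_const v p)).clm_apply (hasFDerivAt_const w p)
    exact h'.congr_fderiv (by simp)
  have h2 := hasFDerivAt_conn_apply hA p
  have h3 := ((h1 v w).sub (h1 w v)).add (((h2 v).mul' (h2 w)).sub ((h2 w).mul' (h2 v)))
  have : fderiv ℝ (fun p => curvature A p v w) p = _ := h3.fderiv
  rw [this]
  simp

/-- The Bianchi identity. -/
lemma bianchi (hA : ContDiff ℝ ∞ A) (p u v w : Spacetime) :
    (fderiv ℝ (fun p => curvature A p v w) p u +
        (A p u * curvature A p v w - curvature A p v w * A p u)) +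
      (fderiv ℝ (fun p => curvature A p w u) p v +
        (A p v * curvature A p w u - curvature A p w u * A p v)) +
      (fderiv ℝ (fun p => curvature A p u v) p w +
        (A p w * curvature A p u v - curvature A p u v * A p w)) = 0 := by
  rw [fderiv_curvature hA, fderiv_curvature hA, fderiv_curvature hA]
  simp only [curvature]
  -- Symmetry of second derivatives kills the terms of d(dA); the remaining products of A and dA,
  -- and the cubic terms in A, cancel algebraically.
  rw [fderiv_fderiv_symm hA p v u, fderiv_fderiv_symm hA p w u, fderiv_fderiv_symm hA p w v]
  noncomm_ring

/-- Differentiating A* = -A and tr A = 0 shows that dA stays in su(2), and su(2) is closed under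
commutators. -/
lemma curvature_isSu2 (hA : ContDiff ℝ ∞ A) (hsu : ∀ p v, IsSu2 (A p v)) (p v w : Spacetime) :
    IsSu2 (curvature A p v w) := by
  have h1 : ∀ v w, IsSu2 (fderiv ℝ A p v w) := by
    intro v w
    have hd := hasFDerivAt_conn_apply hA p w
    constructor
    · have e1 := hd.star
      have e2 := hd.neg
      have : (fun p => star (A p w)) = fun p => -(A p w) := funext fun p => (hsu p w).1
      rw [this] at e1
      simpa using congrArg (· v) (e1.unique e2)
    · have e1 := traceCLM.hasFDerivAt.comp p hd
      have : traceCLM ∘ (fun p => A p w) = fun _ => 0 := funext fun p => (hsu p w).2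
      rw [this] at e1
      simpa using congrArg (· v) (e1.unique (hasFDerivAt_const 0 p))
  constructor
  · simp only [curvature, star_add, star_sub, star_mul, (h1 v w).1, (h1 w v).1, (hsu p v).1,
      (hsu p w).1]
    noncomm_ring
  · simp only [curvature, Mat.trace_add, Mat.trace_sub, (h1 v w).2, (h1 w v).2,
      Mat.trace_mul_comm (A p v)]
    simp

/-! ### Parallel endomorphisms and the scalar two-form tr(Fh) -/

variable {h : Spacetime → Mat}

/-- The curvature commutes with a parallel endomorphism. -/
lemma curvature_comm_of_parallel (hA : ContDiff ℝ ∞ A) (hh : ContDiff ℝ ∞ h)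
    (hpar : ∀ p v, fderiv ℝ h p v = h p * A p v - A p v * h p) (p v w : Spacetime) :
    h p * curvature A p v w = curvature A p v w * h p := by
  have key : ∀ v w, fderiv ℝ (fderiv ℝ h) p w v = h p * fderiv ℝ A p w v + fderiv ℝ h p w * A p v
      - (A p v * fderiv ℝ h p w + fderiv ℝ A p w v * h p) := by
    intro v w
    rw [← fderiv_fderiv_apply hh, show (fun p => fderiv ℝ h p v) =
      fun p => h p * A p v - A p v * h p from funext fun p => hpar p v]
    have h1 := ((hh.differentiable (by simp)) p).hasFDerivAt
    have h2 := hasFDerivAt_conn_apply hA p v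
    have : fderiv ℝ (fun p => h p * A p v - A p v * h p) p = _ :=
      ((h1.mul' h2).sub (h2.mul' h1)).fderiv
    rw [this]
    simp
  -- Integrability: comparing the two mixed second derivatives of h expresses d_A d_A h = 0, which
  -- is the vanishing of [F, h].
  have e := fderiv_fderiv_symm hh p v w
  rw [key, key, hpar, hpar] at e
  rw [← sub_eq_zero] at e ⊢
  rw [← e, curvature]
  noncomm_ring

/-- The scalar two-form `tr (F h)`. -/
def traceForm (A : Spacetime → Spacetime →L[ℝ] Mat) (h : Spacetime → Mat) (v w : Spacetime)
    (p : Spacetime) : ℝ := (curvature A p v w * h p).trace.re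

lemma contDiff_traceForm (hA : ContDiff ℝ ∞ A) (hh : ContDiff ℝ ∞ h) (v w : Spacetime) :
    ContDiff ℝ ∞ (traceForm A h v w) :=
  (Complex.reCLM.comp traceCLM).contDiff.comp ((contDiff_curvature hA v w).mul hh)

lemma traceForm_antisymm (v w p : Spacetime) : traceForm A h w v p = -traceForm A h v w p := by
  have := (Complex.reCLM.comp traceCLM).map_neg (curvature A p v w * h p)
  rw [traceForm, curvature_antisymm, neg_mul]
  exact this

/-- Leibniz rule with d_A h = 0: cyclicity of the trace moves hA - Ah onto F, completing dF to the
covariant derivative of F. -/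
lemma fderiv_traceForm (hA : ContDiff ℝ ∞ A) (hh : ContDiff ℝ ∞ h)
    (hpar : ∀ p v, fderiv ℝ h p v = h p * A p v - A p v * h p) (p u v w : Spacetime) :
    fderiv ℝ (traceForm A h v w) p u =
      (Complex.reCLM.comp traceCLM) ((fderiv ℝ (fun p => curvature A p v w) p u +
        (A p u * curvature A p v w - curvature A p v w * A p u)) * h p) := by
  have h1 := ((contDiff_curvature hA v w).differentiable (by simp) p).hasFDerivAt.mul'
    ((hh.differentiable (by simp)) p).hasFDerivAt
  have h2 : fderiv ℝ (traceForm A h v w) p = _ :=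
    ((Complex.reCLM.comp traceCLM).hasFDerivAt.comp p h1).fderiv
  have e : (curvature A p v w * (h p * A p u)).trace = (A p u * curvature A p v w * h p).trace := by
    rw [← mul_assoc, Mat.trace_mul_comm, mul_assoc]
  rw [h2]
  simp [hpar, add_mul, sub_mul, mul_sub, Mat.trace_add, Mat.trace_sub, e, mul_assoc]
  ring

/-- `tr (F h)` is closed if `h` is parallel. -/
lemma traceForm_closed (hA : ContDiff ℝ ∞ A) (hh : ContDiff ℝ ∞ h)
    (hpar : ∀ p v, fderiv ℝ h p v = h p * A p v - A p v * h p) (p u v w : Spacetime) :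
    fderiv ℝ (traceForm A h v w) p u + fderiv ℝ (traceForm A h w u) p v +
      fderiv ℝ (traceForm A h u v) p w = 0 := by
  rw [fderiv_traceForm hA hh hpar, fderiv_traceForm hA hh hpar, fderiv_traceForm hA hh hpar,
    ← map_add, ← map_add, ← add_mul, ← add_mul, bianchi hA, zero_mul, map_zero]

end Curvature

/-- The equations `div u = 0`, `∂₀ u = - curl u` for a vector field imply that it is harmonic. -/
lemma laplacian_eq_zero_of_curl {u₁ u₂ u₃ : Spacetime → ℝ} {i j k : Fin 4}
    (h₁ : ContDiff ℝ ∞ u₁) (h₂ : ContDiff ℝ ∞ u₂) (h₃ : ContDiff ℝ ∞ u₃)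
    (hijk : ∀ f : Fin 4 → ℝ, ∑ l, f l = f 0 + f i + f j + f k)
    (hdiv : ∀ p, partialDeriv i u₁ p + partialDeriv j u₂ p + partialDeriv k u₃ p = 0)
    (hc₁ : ∀ p, partialDeriv 0 u₁ p = partialDeriv k u₂ p - partialDeriv j u₃ p)
    (hc₂ : ∀ p, partialDeriv 0 u₂ p = partialDeriv i u₃ p - partialDeriv k u₁ p)
    (hc₃ : ∀ p, partialDeriv 0 u₃ p = partialDeriv j u₁ p - partialDeriv i u₂ p)
    (p : Spacetime) : laplacian u₁ p = 0 := by
  have d₁ := contDiff_partialDeriv h₁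
  have d₂ := contDiff_partialDeriv h₂
  have d₃ := contDiff_partialDeriv h₃
  rw [laplacian, hijk]
  -- First component of ∂₀²u = -curl ∂₀u = curl curl u = grad div u - Δ_{ℝ³} u; the term grad div u
  -- then drops out by `e1`.
  have e0 : partialDeriv 0 (partialDeriv 0 u₁) p =
      partialDeriv k (partialDeriv 0 u₂) p - partialDeriv j (partialDeriv 0 u₃) p := by
    rw [show partialDeriv 0 u₁ = fun p => partialDeriv k u₂ p - partialDeriv j u₃ p from funext hc₁,
      partialDeriv_sub (d₂ k) (d₃ j), partialDeriv_comm h₂, partialDeriv_comm h₃]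
  rw [show partialDeriv 0 u₂ = fun p => partialDeriv i u₃ p - partialDeriv k u₁ p from funext hc₂,
    show partialDeriv 0 u₃ = fun p => partialDeriv j u₁ p - partialDeriv i u₂ p from funext hc₃,
    partialDeriv_sub (d₃ i) (d₁ k), partialDeriv_sub (d₁ j) (d₂ i), partialDeriv_comm h₃ k i,
    partialDeriv_comm h₂ j i] at e0
  have e1 : partialDeriv i (fun p => partialDeriv i u₁ p + partialDeriv j u₂ p
      + partialDeriv k u₃ p) p = 0 := by
    rw [show (fun p => partialDeriv i u₁ p + partialDeriv j u₂ p + partialDeriv k u₃ p) =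
      fun _ => 0 from funext hdiv, partialDeriv]
    simp
  rw [partialDeriv_add ((d₁ i).add (d₂ j)) (d₃ k), partialDeriv_add (d₁ i) (d₂ j)] at e1
  linarith

/-- The components `tr (F_{0i} h)` are harmonic if `F` is anti-self-dual and `h` is parallel. -/
lemma laplacian_traceForm {A : Spacetime → Spacetime →L[ℝ] Mat} {h : Spacetime → Mat}
    (hA : ContDiff ℝ ∞ A) (hh : ContDiff ℝ ∞ h)
    (hpar : ∀ p v, fderiv ℝ h p v = h p * A p v - A p v * h p) (hasd : AntiSelfDual A)
    (p : Spacetime) :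
    laplacian (traceForm A h (basisVec 0) (basisVec 1)) p = 0 ∧
    laplacian (traceForm A h (basisVec 0) (basisVec 2)) p = 0 ∧
    laplacian (traceForm A h (basisVec 0) (basisVec 3)) p = 0 := by
  set φ : Fin 4 → Fin 4 → Spacetime → ℝ := fun i j => traceForm A h (basisVec i) (basisVec j)
    with hφ
  have hs : ∀ i j, ContDiff ℝ ∞ (φ i j) := fun i j => contDiff_traceForm hA hh _ _
  have anti : ∀ i j, φ j i = fun p => -φ i j p := fun i j => funext fun p =>
    traceForm_antisymm _ _ _
  have asd : ∀ i j l, (∀ p, curvComp A i j p = -curvComp A 0 l p) →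
      φ i j = fun p => -φ 0 l p := by
    intro i j l hc
    funext p
    have := hc p
    simp only [curvComp] at this
    rw [← traceForm_antisymm, hφ]
    simp only [traceForm, this, curvature_antisymm (v := basisVec 0)]
  have a1 := asd 2 3 1 fun p => (hasd p).1
  have a2 := asd 3 1 2 fun p => (hasd p).2.1
  have a3 := asd 1 2 3 fun p => (hasd p).2.2
  have closed : ∀ i j l p, partialDeriv i (φ j l) p + partialDeriv j (φ l i) p
      + partialDeriv l (φ i j) p = 0 := fun i j l p => traceForm_closed hA hh hpar p _ _ _
  -- Anti-self-duality turns magnetic components into minus electric ones. Closedness on the indices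
  -- 1, 2, 3 then gives div u = 0, and on 0, i, j it gives ∂₀u = -curl u, for the electric field u.
  have hdiv : ∀ p, partialDeriv 1 (φ 0 1) p + partialDeriv 2 (φ 0 2) p
      + partialDeriv 3 (φ 0 3) p = 0 := by
    intro p
    have := closed 1 2 3 p
    rw [a1, a2, a3] at this
    simp only [partialDeriv_neg] at this
    linarith
  have hc1 : ∀ p, partialDeriv 0 (φ 0 1) p =
      partialDeriv 3 (φ 0 2) p - partialDeriv 2 (φ 0 3) p := by
    intro p
    have := closed 0 2 3 p
    rw [a1, anti 0 3] at this
    simp only [partialDeriv_neg] at this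
    linarith
  have hc2 : ∀ p, partialDeriv 0 (φ 0 2) p =
      partialDeriv 1 (φ 0 3) p - partialDeriv 3 (φ 0 1) p := by
    intro p
    have := closed 0 3 1 p
    rw [a2, anti 0 1] at this
    simp only [partialDeriv_neg] at this
    linarith
  have hc3 : ∀ p, partialDeriv 0 (φ 0 3) p =
      partialDeriv 2 (φ 0 1) p - partialDeriv 1 (φ 0 2) p := by
    intro p
    have := closed 0 1 2 p
    rw [a3, anti 0 2] at this
    simp only [partialDeriv_neg] at this
    linarith
  -- The system is invariant under cyclic permutations of 1, 2, 3, so the statement about the first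
  -- component yields all three.
  refine ⟨laplacian_eq_zero_of_curl (i := 1) (j := 2) (k := 3) (hs 0 1) (hs 0 2) (hs 0 3)
      Fin.sum_univ_four hdiv hc1 hc2 hc3 p,
    laplacian_eq_zero_of_curl (i := 2) (j := 3) (k := 1) (hs 0 2) (hs 0 3) (hs 0 1)
      (fun f => by rw [Fin.sum_univ_four]; ring) (fun p => by linarith [hdiv p]) hc2 hc3 hc1 p,
    laplacian_eq_zero_of_curl (i := 3) (j := 1) (k := 2) (hs 0 3) (hs 0 1) (hs 0 2)
      (fun f => by rw [Fin.sum_univ_four]; ring) (fun p => by linarith [hdiv p]) hc3 hc1 hc2 p⟩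


/-! ### Decay of the curvature -/

/-- Naturality of the curvature under pull-back. -/
lemma curvature_pullback {A B : Spacetime → Spacetime →L[ℝ] Mat} (hA : ContDiff ℝ ∞ A)
    {ψ : Spacetime → Spacetime} {q : Spacetime} (hψ : ContDiffAt ℝ ∞ ψ q)
    (hB : B =ᶠ[𝓝 q] fun q => (A (ψ q)).comp (fderiv ℝ ψ q)) (v w : Spacetime) :
    curvature B q v w = curvature A (ψ q) (fderiv ℝ ψ q v) (fderiv ℝ ψ q w) := by
  have hψ2 : (2 : WithTop ℕ∞) ≤ ∞ := WithTop.coe_le_coe.2 (le_top : (2 : ℕ∞) ≤ ⊤)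
  have h1 : HasFDerivAt (fun q => A (ψ q)) ((fderiv ℝ A (ψ q)).comp (fderiv ℝ ψ q)) q :=
    ((hA.differentiable (by simp)) (ψ q)).hasFDerivAt.comp q
      (hψ.differentiableAt (by simp)).hasFDerivAt
  have h2 : HasFDerivAt (fderiv ℝ ψ) (fderiv ℝ (fderiv ℝ ψ) q) q :=
    ((hψ.fderiv_right (m := ∞) le_rfl).differentiableAt (by simp)).hasFDerivAt
  -- Differentiating the pulled-back form produces A(D²ψ(v, w)), which is symmetric and cancels in
  -- the antisymmetrization.
  have hsymm : fderiv ℝ (fderiv ℝ ψ) q v w = fderiv ℝ (fderiv ℝ ψ) q w v :=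
    (hψ.isSymmSndFDerivAt (by simpa using hψ2)).eq v w
  have h3 : fderiv ℝ B q = _ := hB.fderiv_eq.trans (h1.clm_comp h2).fderiv
  simp only [curvature, h3, hB.eq_of_nhds]
  simp [hsymm]

lemma norm_curvature_le (A : Spacetime → Spacetime →L[ℝ] Mat) (p v w : Spacetime) :
    ‖curvature A p v w‖ ≤ (2 * ‖fderiv ℝ A p‖ + 2 * ‖A p‖ ^ 2) * ‖v‖ * ‖w‖ := by
  have h1 : ∀ v w, ‖fderiv ℝ A p v w‖ ≤ ‖fderiv ℝ A p‖ * ‖v‖ * ‖w‖ := fun v w =>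
    (fderiv ℝ A p).le_opNorm₂ v w
  have h2 : ∀ v w, ‖A p v * A p w‖ ≤ ‖A p‖ ^ 2 * ‖v‖ * ‖w‖ := fun v w => by
    refine (norm_mul_le _ _).trans ((mul_le_mul ((A p).le_opNorm v) ((A p).le_opNorm w)
      (norm_nonneg _) (by positivity)).trans (le_of_eq (by ring)))
  have h3 : ‖curvature A p v w‖ ≤ (‖fderiv ℝ A p v w‖ + ‖fderiv ℝ A p w v‖) +
      (‖A p v * A p w‖ + ‖A p w * A p v‖) :=
    (norm_add_le _ _).trans (add_le_add (norm_sub_le _ _) (norm_sub_le _ _))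
  have := h1 v w
  have := h1 w v
  have := h2 v w
  have := h2 w v
  nlinarith

lemma contDiffAt_ballChart {q : Spacetime} (hq : ‖q.2‖ < 1) : ContDiffAt ℝ ∞ ballChart q := by
  have h0 : 1 - ‖q.2‖ ^ 2 ≠ 0 := by nlinarith [norm_nonneg q.2]
  have h1 : ContDiffAt ℝ ∞ (fun q : Spacetime => 1 - ‖q.2‖ ^ 2) q :=
    contDiffAt_const.sub (contDiff_snd.norm_sq ℝ).contDiffAt
  exact contDiffAt_fst.prodMk ((h1.inv h0).smul contDiffAt_snd)

/-- Source of the decay: with s = 1 - |y|², the time direction is unchanged, while spatial vectors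
are stretched by at least 1/s. -/
lemma fderiv_ballChart {q : Spacetime} (hq : ‖q.2‖ < 1) (v : Spacetime) :
    fderiv ℝ ballChart q v = (v.1, (1 - ‖q.2‖ ^ 2)⁻¹ • v.2 +
      (2 * inner ℝ q.2 v.2 / (1 - ‖q.2‖ ^ 2) ^ 2) • q.2) := by
  have h0 : 1 - ‖q.2‖ ^ 2 ≠ 0 := by nlinarith [norm_nonneg q.2]
  have hs : HasFDerivAt (fun q : Spacetime => q.2) (ContinuousLinearMap.snd ℝ ℝ Space) q :=
    hasFDerivAt_snd
  have h1 := (hasDerivAt_inv h0).comp_hasFDerivAt q (hs.norm_sq.const_sub 1)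
  have h2 : HasFDerivAt ballChart _ q := hasFDerivAt_fst.prodMk (h1.smul hs)
  rw [h2.fderiv]
  ext1
  · simp
  · simp
    congr 1
    field_simp

/-- Inverts the ball chart: for |x| = r, the point y = s x is the preimage when s = 1 - |y|². This
is the positive root of r²s² + s - 1 = 0, written with a rationalized numerator so that r = 0 needs
no separate case. The bound on s(1 + r) says s = O(1/r). -/
lemma exists_ball_scale (r : ℝ) :
    ∃ s : ℝ, 0 < s ∧ s * (1 + r) ≤ 2 ∧ 1 - (s * r) ^ 2 = s := by
  have hD := Real.sq_sqrt (show 0 ≤ 1 + 4 * r ^ 2 by positivity)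
  have hD0 := Real.sqrt_nonneg (1 + 4 * r ^ 2)
  have hDr : r ≤ √(1 + 4 * r ^ 2) := Real.le_sqrt_of_sq_le (by nlinarith)
  set D := √(1 + 4 * r ^ 2)
  refine ⟨2 / (1 + D), by positivity, ?_, ?_⟩
  · rw [div_mul_eq_mul_div, div_le_iff₀ (by positivity)]
    linarith
  · field_simp
    linear_combination hD

/-- If the connection extends smoothly to the radial compactification, then the mixed components
of the curvature vanish at spatial infinity. -/
lemma tendsto_curvature {A B : Spacetime → Spacetime →L[ℝ] Mat} (hA : ContDiff ℝ ∞ A)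
    {T : ℝ} (hT : 0 < T) (hper : ∀ t x, A (t + T, x) = A (t, x)) (hB : ContDiff ℝ ∞ B)
    (hAB : ∀ q : Spacetime, ‖q.2‖ < 1 → B q = (A (ballChart q)).comp (fderiv ℝ ballChart q))
    (e : Space) :
    Tendsto (fun p => curvature A p (1, 0) (0, e)) spatialInfinity (𝓝 0) := by
  have hcont : Continuous fun q => 2 * ‖fderiv ℝ B q‖ + 2 * ‖B q‖ ^ 2 := by
    have h1 := (hB.continuous_fderiv (by simp)).norm
    have h2 := hB.continuous.norm
    fun_prop
  obtain ⟨M, hM⟩ := ((isCompact_Icc (a := (0 : ℝ)) (b := T)).prod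
    (isCompact_closedBall (0 : Space) 1)).bddAbove_image hcont.continuousOn
  have hM' : ∀ q : Spacetime, 0 ≤ q.1 → q.1 ≤ T → ‖q.2‖ ≤ 1 → ∀ v w,
      ‖curvature B q v w‖ ≤ M * ‖v‖ * ‖w‖ := fun q h0 h1 h2 v w => by
    refine (norm_curvature_le B q v w).trans ?_
    gcongr
    exact hM ⟨q, ⟨⟨h0, h1⟩, by simpa using h2⟩, rfl⟩
  have hM0 : 0 ≤ M := by
    have := hM ⟨(0, 0), ⟨⟨le_rfl, hT.le⟩, by simp⟩, rfl⟩
    exact le_trans (by positivity) this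
  -- The factor 6 is 3 · 2: the preimage of e has norm at most 3s‖e‖, and s(1 + ‖x‖) ≤ 2.
  have bound : ∀ p : Spacetime, ‖curvature A p (1, 0) (0, e)‖ ≤ M * (6 * ‖e‖) / (1 + ‖p.2‖) := by
    rintro ⟨t, x⟩
    -- The bound `M` holds only over 0 ≤ t ≤ T, so t is first moved there by the periodicity of A.
    have hF : curvature A (t, x) (1, 0) (0, e) =
        curvature A (toIcoMod hT 0 t, x) (1, 0) (0, e) := by
      have : Function.Periodic (fun t => curvature A (t, x) (1, 0) (0, e)) T := fun t =>
        curvature_periodic hper t x _ _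
      rw [toIcoMod, sub_eq_add_neg, ← neg_smul]
      exact (this.zsmul _ t).symm
    have ht := toIcoMod_mem_Ico hT 0 t
    rw [zero_add] at ht
    rw [hF]
    generalize toIcoMod hT 0 t = t' at ht
    obtain ⟨s, hs0, hs2, hs⟩ := exists_ball_scale ‖x‖
    set y : Space := s • x with hy
    have hny : ‖y‖ = s * ‖x‖ := by rw [hy, norm_smul, Real.norm_of_nonneg hs0.le]
    have hys : 1 - ‖y‖ ^ 2 = s := by rw [hny, hs]
    have hy1 : ‖y‖ < 1 := by
      have h := norm_nonneg y
      nlinarith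
    -- The spatial differential is s⁻¹(1 + (2/s) y yᵀ), a rank-one perturbation. Its inverse sends e
    -- to s(e - c y), with denominator s + 2|y|² = 1 + |y|².
    set c : ℝ := 2 * inner ℝ y e / (1 + ‖y‖ ^ 2) with hc
    have hchart : ballChart (t', y) = (t', x) := by
      simp only [ballChart, hys]
      rw [hy, smul_smul, inv_mul_cancel₀ hs0.ne', one_smul]
    have hev : B =ᶠ[𝓝 ((t', y) : Spacetime)]
        fun q => (A (ballChart q)).comp (fderiv ℝ ballChart q) := by
      have : ∀ᶠ q : Spacetime in 𝓝 (t', y), ‖q.2‖ < 1 :=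
        (continuous_snd.norm.tendsto ((t', y) : Spacetime)).eventually (gt_mem_nhds hy1)
      filter_upwards [this] with q hq using hAB q hq
    have hpull := curvature_pullback hA (contDiffAt_ballChart (q := (t', y)) hy1) hev
      (1, 0) (0, s • (e - c • y))
    have hv : fderiv ℝ ballChart (t', y) (1, 0) = (1, 0) := by
      rw [fderiv_ballChart (q := (t', y)) hy1]
      simp
    have hw : fderiv ℝ ballChart (t', y) (0, s • (e - c • y)) = (0, e) := by
      rw [fderiv_ballChart (q := (t', y)) hy1]
      simp only [hys]
      rw [smul_smul, inv_mul_cancel₀ hs0.ne', one_smul]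
      have hcoef : 2 * inner ℝ y (s • (e - c • y)) / s ^ 2 = c := by
        rw [inner_smul_right, inner_sub_right, inner_smul_right, real_inner_self_eq_norm_sq,
          div_eq_iff (by positivity)]
        have h1 : c * (1 + ‖y‖ ^ 2) = 2 * inner ℝ y e := by
          rw [hc]; field_simp
        have h2 : ‖y‖ ^ 2 = 1 - s := by linarith
        rw [h2] at h1 ⊢
        linear_combination -s * h1
      rw [hcoef]
      simp
    rw [hv, hw, hchart] at hpull
    rw [← hpull]
    refine (hM' (t', y) ht.1 ht.2.le hy1.le _ _).trans ?_
    have hce : ‖c • y‖ ≤ 2 * ‖e‖ := by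
      rw [norm_smul, hc, norm_div, norm_mul, Real.norm_of_nonneg (by positivity : 0 ≤ 1 + ‖y‖ ^ 2),
        Real.norm_of_nonneg (by norm_num : (0 : ℝ) ≤ 2), div_mul_eq_mul_div,
        div_le_iff₀ (by positivity)]
      have h1 := norm_inner_le_norm (𝕜 := ℝ) y e
      have h2 : ‖inner ℝ y e‖ * ‖y‖ ≤ ‖y‖ * ‖e‖ * ‖y‖ :=
        mul_le_mul_of_nonneg_right h1 (norm_nonneg y)
      nlinarith [norm_nonneg e]
    have hnw : ‖s • (e - c • y)‖ ≤ s * (3 * ‖e‖) := by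
      rw [norm_smul, Real.norm_of_nonneg hs0.le]
      have := norm_sub_le e (c • y)
      gcongr
      linarith
    have n1 : ‖((1, 0) : Spacetime)‖ = 1 := by simp [Prod.norm_def]
    have n2 : ‖((0, s • (e - c • y)) : Spacetime)‖ = ‖s • (e - c • y)‖ := by simp [Prod.norm_def]
    rw [n1, n2, mul_one, mul_div_assoc]
    refine mul_le_mul_of_nonneg_left (hnw.trans ?_) hM0
    rw [le_div_iff₀ (by positivity)]
    nlinarith [norm_nonneg e]
  refine squeeze_zero_norm bound ?_
  have h1 : Tendsto (fun p : Spacetime => ‖p.2‖) spatialInfinity atTop := tendsto_comap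
  exact (tendsto_atTop_add_const_left _ 1 h1).const_div_atTop _


/-! ### Vanishing of the curvature -/

/-- A parallel endomorphism that changes sign around the circle is trace-free. -/
lemma trace_eq_zero_of_parallel {A : Spacetime → Spacetime →L[ℝ] Mat} {h : Spacetime → Mat}
    (hh : ContDiff ℝ ∞ h) (hpar : ∀ p v, fderiv ℝ h p v = h p * A p v - A p v * h p) {T : ℝ}
    (hanti : ∀ t x, h (t + T, x) = -h (t, x)) (p : Spacetime) : (h p).trace = 0 := by
  have hd : ∀ p, HasFDerivAt (fun p => traceCLM (h p)) (traceCLM.comp (fderiv ℝ h p)) p := fun p =>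
    traceCLM.hasFDerivAt.comp p ((hh.differentiable (by simp)) p).hasFDerivAt
  -- The derivative of tr h is the trace of a commutator, so tr h is constant; comparing points one
  -- period apart gives tr h = -tr h.
  have hconst := is_const_of_fderiv_eq_zero (𝕜 := ℝ) (f := fun p => traceCLM (h p))
    (fun p => (hd p).differentiableAt) (fun p => by
      rw [(hd p).fderiv]
      refine ContinuousLinearMap.ext fun v => ?_
      simp [hpar, Mat.trace_sub, Mat.trace_mul_comm (h p)]) (p.1 + T, p.2) p
  simp only [hanti, map_neg, traceCLM_apply] at hconst
  exact neg_eq_self.1 hconst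

/-- Conjugation sends tr(XY) to tr(YX) = tr(XY). So the real part of tr(Fh), the part that
`traceForm` retains, is all of it. -/
lemma im_trace_mul_eq_zero {X Y : Mat} (hX : star X = -X) (hY : star Y = -Y) :
    (X * Y).trace.im = 0 := by
  have h : star (X * Y).trace = (X * Y).trace := by
    rw [← Mat.trace_star, star_mul, hX, hY, neg_mul_neg, Mat.trace_mul_comm]
  exact Complex.conj_eq_iff_im.1 h

-- The norm is the maximal row sum, not the spectral norm, so two entries of modulus at most 1 give
-- the bound 2.
open scoped Matrix.Norms.Operator in
lemma matrix_norm_le_of_mem_unitaryGroup {U : Matrix (Fin 2) (Fin 2) ℂ}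
    (hU : U ∈ Matrix.unitaryGroup (Fin 2) ℂ) : ‖U‖ ≤ 2 := by
  rw [Matrix.linfty_opNorm_def, ← NNReal.coe_ofNat, NNReal.coe_le_coe]
  refine Finset.sup_le fun i _ => ?_
  rw [← NNReal.coe_le_coe, Fin.sum_univ_two]
  push_cast
  linarith [entry_norm_bound_of_unitary hU i 0, entry_norm_bound_of_unitary hU i 1]

lemma norm_le_of_SU2 {g : Mat} (hg : g ∈ SU2) : ‖g‖ ≤ 2 :=
  matrix_norm_le_of_mem_unitaryGroup (Matrix.mem_specialUnitaryGroup_iff.1 hg).1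

/-- An anti-self-dual connection which extends to the radial compactification, and which admits a
parallel `SU(2)`-valued endomorphism changing sign around the circle, has no electric curvature. -/
lemma curvComp_eq_zero {A B : Spacetime → Spacetime →L[ℝ] Mat} {h : Spacetime → Mat} {T : ℝ}
    (hT : 0 < T) (hA : ContDiff ℝ ∞ A) (hsu : ∀ p v, IsSu2 (A p v))
    (hper : ∀ t x, A (t + T, x) = A (t, x)) (hasd : AntiSelfDual A) (hB : ContDiff ℝ ∞ B)
    (hAB : ∀ q : Spacetime, ‖q.2‖ < 1 → B q = (A (ballChart q)).comp (fderiv ℝ ballChart q))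
    (hh : ContDiff ℝ ∞ h) (hU : ∀ p, h p ∈ SU2)
    (hpar : ∀ p v, fderiv ℝ h p v = h p * A p v - A p v * h p)
    (hanti : ∀ t x, h (t + T, x) = -h (t, x)) (p : Spacetime) :
    curvComp A 0 1 p = 0 ∧ curvComp A 0 2 p = 0 ∧ curvComp A 0 3 p = 0 := by
  have htr := trace_eq_zero_of_parallel hh hpar hanti
  have hskew : ∀ p, star (h p) = -h p := fun p => star_eq_neg_of_SU2 (hU p) (htr p)
  have key : ∀ e : Space, (∀ p, laplacian (traceForm A h (1, 0) (0, e)) p = 0) →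
      curvature A p (1, 0) (0, e) = 0 := by
    intro e hΔ
    have hlim : Tendsto (traceForm A h (1, 0) (0, e)) spatialInfinity (𝓝 0) := by
      have h1 : Tendsto (fun p => curvature A p (1, 0) (0, e) * h p) spatialInfinity (𝓝 0) := by
        have h0 := (tendsto_curvature hA hT hper hB hAB e).norm.mul_const 2
        rw [norm_zero, zero_mul] at h0
        refine squeeze_zero_norm (fun p => ?_) h0
        exact (norm_mul_le _ _).trans
          (mul_le_mul_of_nonneg_left (norm_le_of_SU2 (hU p)) (norm_nonneg _))
      have h2 := ((Complex.reCLM.comp traceCLM).continuous.tendsto 0).comp h1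
      rw [map_zero] at h2
      exact h2
    -- The endomorphism h is anti-periodic, so tr(Fh) is anti-periodic with shift T and periodic
    -- only with 2T.
    have hform := eq_zero_of_harmonic (contDiff_traceForm hA hh _ _) (T := T + T) (by linarith)
      (fun t x => by
        simp only [traceForm, ← add_assoc, curvature_periodic hper, hanti, neg_neg]) hΔ hlim p
    have hF := curvature_isSu2 hA hsu p (1, 0) (0, e)
    have h0 : (curvature A p (1, 0) (0, e) * h p).trace = 0 :=
      Complex.ext hform (im_trace_mul_eq_zero hF.1 (hskew p))
    -- F and h now anticommute; they also commute, so 2Fh = 0, and h is invertible.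
    have h1 := anticomm_of_trace_eq_zero hF.2 (htr p) h0
    rw [curvature_comm_of_parallel hA hh hpar, ← two_smul ℝ] at h1
    have h2 := (smul_eq_zero.1 h1).resolve_left two_ne_zero
    calc curvature A p (1, 0) (0, e) = curvature A p (1, 0) (0, e) * h p * star (h p) := by
          rw [mul_assoc, mul_star_of_SU2 (hU p), mul_one]
      _ = 0 := by rw [h2, zero_mul]
  have hlap := laplacian_traceForm hA hh hpar hasd
  exact ⟨key _ fun p => (hlap p).1, key _ fun p => (hlap p).2.1, key _ fun p => (hlap p).2.2⟩

/-- Each term of tr(F ∧ F) pairs an electric component F_{0i} with a magnetic one. -/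
lemma charge_eq_zero_of_curvComp {A : Spacetime → Spacetime →L[ℝ] Mat} (μ₀ : ℝ)
    (h : ∀ p, curvComp A 0 1 p = 0 ∧ curvComp A 0 2 p = 0 ∧ curvComp A 0 3 p = 0) :
    charge μ₀ A = 0 := by
  have hz : (0 : Mat).trace = 0 := traceCLM.map_zero
  have : ∀ p, chernDensity A p = 0 := fun p => by
    simp [chernDensity, (h p).1, (h p).2.1, (h p).2.2, hz]
  simp [charge, this]

/-- A framed connection whose class is fixed by `P(θ) ρ` has a parallel endomorphism which changes
sign around the circle. -/
lemma exists_parallel_of_fixed {μ₀ : ℝ} (hμ₀ : 0 < μ₀) (θ : ℝ) (a : FramedConnection μ₀)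
    (hfix : (phase μ₀ θ * rotation μ₀) (⟦a⟧ : ModuliSpace μ₀) = ⟦a⟧) :
    ∃ h : Spacetime → Mat, ContDiff ℝ ∞ h ∧ (∀ p, h p ∈ SU2) ∧
      (∀ p v, fderiv ℝ h p v = h p * a.conn p v - a.conn p v * h p) ∧
      ∀ t x, h (t + period μ₀, x) = -h (t, x) := by
  have hequiv : GaugeEquiv
      (a.rotate.pullback EuclideanIsometry.id (diagPhase θ) (diagPhase_mem θ)) a :=
    Quotient.exact hfix
  obtain ⟨g, hs, hU, hp, hA, -⟩ := hequiv.symm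
  have hc := largeGauge_contDiff μ₀
  have cU := largeGauge_mem μ₀
  -- Both g and c carry A to the same rotated connection, so c⁻¹g preserves A, that is, it is
  -- parallel. It inherits its sign change from c, because g is periodic.
  refine ⟨fun p => star (largeGauge μ₀ p) * g p, (contDiff_star hc).mul hs,
    fun p => mul_mem (star_mem_SU2 (cU p)) (hU p), fun p v => ?_, fun t x => ?_⟩
  · have h1 := (gaugeTakes_iff hU).1 hA p v
    have h2 := (gaugeTakes_iff cU).1 a.rotate_gaugeTakes p v
    -- A phase is a pull-back by the identity isometry: it alters the framing and leaves the
    -- connection alone.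
    have h3 : (a.rotate.pullback EuclideanIsometry.id (diagPhase θ) (diagPhase_mem θ)).conn p v =
        a.rotate.conn p v := by
      simp [FramedConnection.pullback, EuclideanIsometry.id, EuclideanIsometry.toFun,
        EuclideanIsometry.lin, EuclideanIsometry.sgn]
    rw [h3] at h1
    rw [fderiv_mul_mat (contDiff_star hc) hs, fderiv_star_mat hc, h1, h2]
    simp only [star_sub, star_mul, (a.conn_su2 p v).1, (a.rotate.conn_su2 p v).1]
    noncomm_ring
  · have : largeGauge μ₀ (t + period μ₀, x) = -largeGauge μ₀ (t, x) := by
      simp only [largeGauge, mul_add, diagPhase_add]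
      rw [show μ₀ / 2 * period μ₀ = Real.pi by unfold period; field_simp, diagPhase_pi]
      simp
    simp only [this, hp, star_neg, neg_mul]

end Caloron

end

theorem proposition3p1 (μ₀ : ℝ) (hμ₀ : 0 < μ₀) (k : ℕ) (hk : 0 < k)
    (H : Subgroup (Equiv.Perm (Caloron.ModuliSpace μ₀))) (hH : H ≤ Caloron.symmetryGroup μ₀)
    (θ : ℝ) (hθ : Caloron.phase μ₀ θ * Caloron.rotation μ₀ ∈ H) :
    Caloron.symmetricCalorons μ₀ k H = ∅ := by
  refine Set.eq_empty_of_forall_notMem ?_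
  rintro x ⟨⟨a, ha, rfl⟩, hfix⟩
  obtain ⟨h, hh, hU, hpar, hanti⟩ := Caloron.exists_parallel_of_fixed hμ₀ θ a (hfix _ hθ)
  obtain ⟨B, hB, hAB, -⟩ := ha.boundary
  have hT : 0 < Caloron.period μ₀ := by unfold Caloron.period; positivity
  have hcharge := Caloron.charge_eq_zero_of_curvComp μ₀ (Caloron.curvComp_eq_zero hT a.conn_smooth
    a.conn_su2 a.conn_periodic ha.asd hB hAB hh hU hpar hanti)
  rw [ha.charge_eq] at hcharge
  exact hk.ne' (by exact_mod_cast hcharge)
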